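/- Let $a,b>0$, let $V:\mathbb R^3\to\mathbb R$ and $f:\mathbb R^3\times\mathbb R\to\mathbb R$, and put $V^{+}=\max\{V,0\}$, $F(x,t)=\int_0^t f(x,s)\,ds$. Assume: - (V1) $V$ is continuous and bounded below, and there is $M>0$ such that the set $\{x\in\mathbb R^3: V^+(x)<M\}$ is nonempty and has finite Lebesgue measure. - (f1) $f\in C^1(\mathbb R^3\times\mathbb R,\mathbb R)$, and there are $p\in(2,6)$ and $C>0$ with $|f(x,t)|\le C(1+|t|^{p-1})$ for all $(x,t)\in\mathbb R^3\times\mathbb R$. - (f2) $f(x,t)=o(t)$ as $t\to0$, uniformly in $x\in\mathbb R^3$, and $\lim_{|t|\to\infty}F(x,t)/t^4=+\infty$ for every $x\in\mathbb R^3$. - (f3) There are $a_0,b_0>0$ and $\alpha\in(0,\min\{p',5p'-6\})$, where $\frac1p+\frac1{p'}=1$, such that $$0<\Big(4+\frac{1}{a_0|t|^{\alpha}+b_0}\Big)F(x,t)\le t f(x,t)\qquad\text{for all }x\in\mathbb R^3,\ t\ne0.$$ Let $E=\{u\in H^1(\mathbb R^3):\int_{\mathbb R^3}(a|\nabla u|^2+V^+u^2)\,dx<\infty\}$,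 with the inner product $\langle u,v\rangle=\int_{\mathbb R^3}(a\nabla u\cdot\nabla v+V^+uv)\,dx$ and the corresponding norm $\|\cdot\|$, and let $$\Phi(u)=\frac12\int_{\mathbb R^3}\big(a|\nabla u|^2+Vu^2\big)dx+\frac b4\Big(\int_{\mathbb R^3}|\nabla u|^2dx\Big)^2-\int_{\mathbb R^3}F(x,u)\,dx,\qquad u\in E.$$ Then for every $c\in\mathbb R$, every Cerami sequence of $\Phi$ at level $c$, that is, every sequence $(u_n)\subset E$ with $\Phi(u_n)\to c$ and $(1+\|u_n\|)\,\|\Phi'(u_n)\|_{E^*}\to0$, is bounded in $E$. -/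

import Mathlib

open MeasureTheory Filter Topology
open scoped ContDiff

noncomputable section

namespace Kirchhoff

/-- The Euclidean space `ℝ³`. -/
abbrev R3 : Type := EuclideanSpace ℝ (Fin 3)

/-- `g` is the weak gradient of `u` on `ℝ³`: integration by parts holds against every smooth
compactly supported test function, in every coordinate direction. -/
def HasWeakGradient (u : R3 → ℝ) (g : R3 → R3) : Prop :=
  ∀ φ : R3 → ℝ, ContDiff ℝ ∞ φ → HasCompactSupport φ → ∀ i : Fin 3,
    ∫ x, u x * fderiv ℝ φ x (EuclideanSpace.single i 1) = - ∫ x, g x i * φ x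

lemma integrable_mul_of_lp {u v : R3 → ℝ} (hu : MemLp u 2 volume) (hv : MemLp v 2 volume) :
    Integrable (fun x => u x * v x) volume := hu.integrable_mul hv

lemma testFunction_memLp {φ : R3 → ℝ} (h : Continuous φ) (hc : HasCompactSupport φ) :
    MemLp φ 2 volume := h.memLp_of_hasCompactSupport hc

lemma continuous_partial {φ : R3 → ℝ} (h : ContDiff ℝ ∞ φ) (v : R3) :
    Continuous (fun x => fderiv ℝ φ x v) :=
  (h.continuous_fderiv (by simp)).clm_apply continuous_const

lemma compactSupport_partial {φ : R3 → ℝ} (hc : HasCompactSupport φ) (v : R3) :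
    HasCompactSupport (fun x => fderiv ℝ φ x v) := hc.fderiv_apply ℝ v

lemma coord_memLp {g : R3 → R3} (hg : MemLp g 2 volume) (i : Fin 3) :
    MemLp (fun x => g x i) 2 volume := by
  refine hg.of_le ?_ (Eventually.of_forall fun x => PiLp.norm_apply_le (g x) i)
  exact (EuclideanSpace.proj (𝕜 := ℝ) i).continuous.comp_aestronglyMeasurable
    hg.aestronglyMeasurable

/-- A square-integrable function on `ℝ³` whose weak gradient vanishes is zero. -/
lemma ae_eq_zero_of_weakGradient_zero {u : R3 → ℝ} (hu : MemLp u 2 volume)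
    {g : R3 → R3} (hg : g =ᵐ[volume] 0) (h : HasWeakGradient u g) : u =ᵐ[volume] 0 := by
  have hloc : LocallyIntegrable u volume := hu.locallyIntegrable (by norm_num)
  refine ae_eq_zero_of_integral_contDiff_smul_eq_zero hloc fun φ hφ hc => ?_
  set e : R3 := EuclideanSpace.single 0 1 with he
  have hen : ‖e‖ = 1 := by simp [he]
  obtain ⟨R, hR⟩ := hc.isCompact.isBounded.subset_closedBall (0 : R3)
  have hshift : ∀ t : ℝ, ContDiff ℝ ∞ (fun x => φ (x + t • e)) := fun t =>
    hφ.comp (contDiff_id.add contDiff_const)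
  have hshiftc : ∀ t : ℝ, HasCompactSupport (fun x => φ (x + t • e)) := fun t =>
    hc.comp_homeomorph (Homeomorph.addRight (t • e))
  have hd : ∀ (t : ℝ) (x : R3), fderiv ℝ (fun x => φ (x + t • e)) x e = fderiv ℝ φ (x + t • e) e := by
    intro t x; rw [fderiv_comp_add_right]
  have hzero : ∀ t : ℝ, ∫ x, u x * fderiv ℝ φ (x + t • e) e = 0 := by
    intro t
    have h1 := h _ (hshift t) (hshiftc t) 0
    simp only [← he, hd] at h1
    rw [h1, neg_eq_zero]
    refine integral_eq_zero_of_ae ?_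
    filter_upwards [hg] with x hx
    simp [hx]
  -- the pairing with translates is constant
  set G : ℝ → ℝ := fun t => ∫ x, u x * φ (x + t • e) with hG
  obtain ⟨C, hC⟩ := (continuous_partial hφ e).bounded_above_of_compact_support
    (compactSupport_partial hc e)
  have hC0 : 0 ≤ C := (norm_nonneg _).trans (hC 0)
  have hderiv : ∀ t, HasDerivAt G 0 t := by
    intro t
    have key := hasDerivAt_integral_of_dominated_loc_of_deriv_le (μ := (volume : Measure R3))
      (F := fun t x => u x * φ (x + t • e)) (x₀ := t) (s := Metric.ball t 1)
      (F' := fun t x => u x * fderiv ℝ φ (x + t • e) e)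
      (bound := fun x => (Metric.closedBall (0 : R3) (R + |t| + 1)).indicator
        (fun x => ‖u x‖ * C) x)
      (Metric.ball_mem_nhds t one_pos)
      (Eventually.of_forall fun s => hu.1.mul (hshift s).continuous.aestronglyMeasurable)
      (integrable_mul_of_lp hu (testFunction_memLp (hshift t).continuous (hshiftc t)))
      (hu.1.mul ((continuous_partial hφ e).comp
        (continuous_id.add continuous_const)).aestronglyMeasurable)
      (Eventually.of_forall fun x s hs => ?_) ?_
      (Eventually.of_forall fun x s hs => ?_)
    · have := key.2
      rwa [hzero t] at this
    · by_cases hx : x ∈ Metric.closedBall (0 : R3) (R + |t| + 1)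
      · rw [Set.indicator_of_mem hx, norm_mul]
        exact mul_le_mul_of_nonneg_left (hC _) (norm_nonneg _)
      · rw [Set.indicator_of_notMem hx]
        have hx' : x + s • e ∉ tsupport φ := by
          intro hmem
          have h1 := hR hmem
          rw [mem_closedBall_zero_iff] at h1 hx
          apply hx
          have h2 : ‖x‖ ≤ ‖x + s • e‖ + ‖s • e‖ := by
            simpa using norm_sub_le (x + s • e) (s • e)
          rw [norm_smul, hen, mul_one, Real.norm_eq_abs] at h2
          rw [Metric.mem_ball, Real.dist_eq] at hs
          have h3 : |s| ≤ |t| + |s - t| := by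
            simpa using abs_add_le t (s - t)
          linarith
        have : fderiv ℝ φ (x + s • e) = 0 := by
          by_contra hne
          exact hx' (support_fderiv_subset ℝ hne)
        simp [this]
    · have : IntegrableOn (fun x => ‖u x‖ * C) (Metric.closedBall (0 : R3) (R + |t| + 1))
          volume :=
        ((hloc.integrableOn_isCompact (isCompact_closedBall _ _)).norm).mul_const C
      exact this.integrable_indicator measurableSet_closedBall
    · have h1 : HasDerivAt (fun s : ℝ => x + s • e) e s := by
        simpa using ((hasDerivAt_id s).smul_const e).const_add x
      have h2 := ((hφ.differentiable (by simp)) (x + s • e)).hasFDerivAt.comp_hasDerivAt s h1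
      exact h2.const_mul (u x)
  have hconst : ∀ t, G t = G 0 := fun t =>
    is_const_of_deriv_eq_zero (fun s => (hderiv s).differentiableAt)
      (fun s => (hderiv s).deriv) t 0
  -- translates to infinity decouple from `u`
  have hu2 : Integrable (fun x => u x ^ 2) volume := hu.integrable_sq
  have hφ2 : Integrable (fun x => φ x ^ 2) volume :=
    (testFunction_memLp hφ.continuous hc).integrable_sq
  have htail : Tendsto (fun n : ℕ => ∫ x, (Metric.ball (0 : R3) n)ᶜ.indicator
      (fun x => u x ^ 2) x) atTop (𝓝 0) := by
    have := tendsto_integral_of_dominated_convergence (μ := (volume : Measure R3))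
      (F := fun (n : ℕ) x => (Metric.ball (0 : R3) n)ᶜ.indicator (fun x => u x ^ 2) x)
      (f := fun _ => 0) (fun x => u x ^ 2)
      (fun n => (hu2.indicator measurableSet_ball.compl).aestronglyMeasurable) hu2
      (fun n => Eventually.of_forall fun x => by
        refine (norm_indicator_le_norm_self _ _).trans ?_
        simp)
      (Eventually.of_forall fun x => by
        obtain ⟨N, hN⟩ := exists_nat_gt ‖x‖
        refine tendsto_const_nhds.congr' ?_
        filter_upwards [eventually_ge_atTop N] with n hn
        rw [Set.indicator_of_notMem]
        simp only [Set.mem_compl_iff, not_not, mem_ball_zero_iff]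
        exact hN.trans_le (by exact_mod_cast hn))
    simpa using this
  have hbound : ∀ δ : ℝ, 0 < δ → ∀ n : ℕ, |G 0| ≤ (1 / δ) * (∫ x,
      (Metric.ball (0 : R3) n)ᶜ.indicator (fun x => u x ^ 2) x) + δ * ∫ x, φ x ^ 2 := by
    intro δ hδ n
    rw [← hconst (n + |R|)]
    have hsh : ∫ x, φ x ^ 2 = ∫ x, φ (x + (n + |R|) • e) ^ 2 :=
      (integral_add_right_eq_self (fun x => φ x ^ 2) _).symm
    have hint2 : Integrable (fun x => φ (x + ((n : ℝ) + |R|) • e) ^ 2) volume :=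
      hφ2.comp_add_right _
    have hint1 := hu2.indicator (measurableSet_ball (x := (0 : R3)) (ε := n)).compl
    rw [hsh, ← integral_const_mul, ← integral_const_mul, ← integral_add
      (hint1.const_mul _) (hint2.const_mul _), ← Real.norm_eq_abs]
    refine norm_integral_le_of_norm_le ((hint1.const_mul _).add (hint2.const_mul _))
      (Eventually.of_forall fun x => ?_)
    by_cases hx : x ∈ Metric.ball (0 : R3) n
    · have hx' : φ (x + ((n : ℝ) + |R|) • e) = 0 := by
        by_contra hne
        have h1 := hR (subset_tsupport _ hne)
        rw [mem_closedBall_zero_iff] at h1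
        rw [mem_ball_zero_iff] at hx
        have h2 : ‖((n : ℝ) + |R|) • e‖ ≤ ‖x + ((n : ℝ) + |R|) • e‖ + ‖x‖ := by
          simpa using norm_sub_le (x + ((n : ℝ) + |R|) • e) x
        rw [norm_smul, hen, mul_one, Real.norm_of_nonneg (by positivity)] at h2
        linarith [le_abs_self R]
      simp [hx', hx]
    · rw [Set.indicator_of_mem (show x ∈ (Metric.ball (0 : R3) n)ᶜ from hx), Real.norm_eq_abs]
      set p := u x
      set q := φ (x + ((n : ℝ) + |R|) • e)
      have h1 : 0 ≤ (1 / δ) * (|p| - δ * |q|) ^ 2 := by positivity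
      have h2 : (1 / δ) * (|p| - δ * |q|) ^ 2
          = (1 / δ) * p ^ 2 + δ * q ^ 2 - 2 * (|p| * |q|) := by
        rw [← sq_abs p, ← sq_abs q]; field_simp
        try ring
      rw [abs_mul]
      have : 0 ≤ |p| * |q| := by positivity
      linarith
  have hlim : ∀ δ : ℝ, 0 < δ → |G 0| ≤ δ * ∫ x, φ x ^ 2 := by
    intro δ hδ
    have := ((htail.const_mul (1 / δ)).add_const (δ * ∫ x, φ x ^ 2))
    rw [mul_zero, zero_add] at this
    exact ge_of_tendsto' this (hbound δ hδ)
  have hI : 0 ≤ ∫ x, φ x ^ 2 := integral_nonneg fun x => sq_nonneg _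
  have hG0 : |G 0| ≤ 0 := by
    refine le_of_forall_pos_le_add fun ε hε => ?_
    have h1 := hlim (ε / ((∫ x, φ x ^ 2) + 1)) (by positivity)
    have h2 : ε / ((∫ x, φ x ^ 2) + 1) * (∫ x, φ x ^ 2) ≤ ε := by
      rw [div_mul_eq_mul_div, div_le_iff₀ (by positivity)]
      nlinarith
    linarith
  have h0 : G 0 = 0 := abs_nonpos_iff.mp hG0
  simp only [hG, zero_smul, add_zero] at h0
  simpa [mul_comm] using h0

/-- The positive part `V⁺ = max{V, 0}` of the potential. -/
def Vplus (V : C(R3, ℝ)) (x : R3) : ℝ := max (V x) 0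

lemma Vplus_nonneg (V : C(R3, ℝ)) (x : R3) : 0 ≤ Vplus V x := le_max_right _ _

lemma continuous_Vplus (V : C(R3, ℝ)) : Continuous (Vplus V) :=
  V.continuous.max continuous_const

lemma integrable_Vplus_mul {V : C(R3, ℝ)} {u v : R3 → ℝ}
    (hu : AEStronglyMeasurable u volume) (hv : AEStronglyMeasurable v volume)
    (hu2 : Integrable (fun x => Vplus V x * u x ^ 2) volume)
    (hv2 : Integrable (fun x => Vplus V x * v x ^ 2) volume) :
    Integrable (fun x => Vplus V x * (u x * v x)) volume := by
  refine (hu2.add hv2).mono'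
    ((continuous_Vplus V).aestronglyMeasurable.mul (hu.mul hv))
    (Eventually.of_forall fun x => ?_)
  have h0 := Vplus_nonneg V x
  rw [norm_mul, Real.norm_of_nonneg h0, Real.norm_eq_abs, abs_mul]
  have h1 : |u x| * |v x| ≤ u x ^ 2 + v x ^ 2 := by
    rw [← sq_abs (u x), ← sq_abs (v x)]
    nlinarith [sq_nonneg (|u x| - |v x|), sq_nonneg (|u x|), sq_nonneg (|v x|)]
  calc Vplus V x * (|u x| * |v x|) ≤ Vplus V x * (u x ^ 2 + v x ^ 2) :=
        mul_le_mul_of_nonneg_left h1 h0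
    _ = _ := by simp [mul_add]

lemma HasWeakGradient.congr {u u' : R3 → ℝ} {g g' : R3 → R3} (h : HasWeakGradient u g)
    (hu : u =ᵐ[volume] u') (hg : g =ᵐ[volume] g') : HasWeakGradient u' g' := by
  intro φ hφ hc i
  have h1 := h φ hφ hc i
  have e1 : ∫ x, u x * fderiv ℝ φ x (EuclideanSpace.single i 1)
      = ∫ x, u' x * fderiv ℝ φ x (EuclideanSpace.single i 1) :=
    integral_congr_ae (by filter_upwards [hu] with x hx; rw [hx])
  have e2 : ∫ x, g x i * φ x = ∫ x, g' x i * φ x :=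
    integral_congr_ae (by filter_upwards [hg] with x hx; rw [hx])
  rw [← e1, ← e2, h1]

/-- A square-integrable weak gradient is unique up to null sets. -/
lemma HasWeakGradient.unique {u : R3 → ℝ} {g g' : R3 → R3} (h : HasWeakGradient u g)
    (h' : HasWeakGradient u g') (hg : MemLp g 2 volume) (hg' : MemLp g' 2 volume) :
    g =ᵐ[volume] g' := by
  have key : ∀ i : Fin 3, ∀ᵐ x ∂(volume : Measure R3), g x i = g' x i := fun i =>
    ae_eq_of_integral_contDiff_smul_eq
      ((coord_memLp hg i).locallyIntegrable (by norm_num))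
      ((coord_memLp hg' i).locallyIntegrable (by norm_num)) fun φ hφ hc => by
        have := (h φ hφ hc i).symm.trans (h' φ hφ hc i)
        simpa [mul_comm] using this
  filter_upwards [ae_all_iff.mpr key] with x hx
  exact PiLp.ext hx

/-- The linear space underlying `E`: a function `u ∈ H¹(ℝ³)` is recorded together with its
weak gradient as the pair `(u, ∇u) ∈ L²(ℝ³) × L²(ℝ³; ℝ³)`, and `∫ V⁺ u² < ∞` is required
(`∫ a |∇u|² < ∞` is automatic). The second component is determined by the first
(`HasWeakGradient.unique`). -/
def energySubmodule (V : C(R3, ℝ)) :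
    Submodule ℝ (Lp ℝ 2 (volume : Measure R3) × Lp R3 2 (volume : Measure R3)) where
  carrier := {w | HasWeakGradient w.1 w.2 ∧
    Integrable (fun x => Vplus V x * (w.1 x) ^ 2) volume}
  zero_mem' := by
    refine ⟨HasWeakGradient.congr (u := 0) (g := 0) ?_
      (Lp.coeFn_zero ℝ 2 volume).symm (Lp.coeFn_zero R3 2 volume).symm, ?_⟩
    · intro φ hφ hc i; simp
    · refine (integrable_zero R3 ℝ volume).congr ?_
      filter_upwards [Lp.coeFn_zero ℝ 2 (volume : Measure R3)] with x hx
      simp only [Pi.zero_apply] at hx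
      rw [Prod.fst_zero, hx]; simp
  add_mem' := by
    rintro ⟨u, g⟩ ⟨v, k⟩ ⟨h1, h2⟩ ⟨h3, h4⟩
    refine ⟨HasWeakGradient.congr (u := u + v) (g := g + k) ?_
      (Lp.coeFn_add u v).symm (Lp.coeFn_add g k).symm, ?_⟩
    · intro φ hφ hc i
      have hp := testFunction_memLp (continuous_partial hφ (EuclideanSpace.single i 1))
        (compactSupport_partial hc _)
      have hq := testFunction_memLp hφ.continuous hc
      have e1 := h1 φ hφ hc i
      have e2 := h3 φ hφ hc i
      simp only [Pi.add_apply, PiLp.add_apply, add_mul] at e1 e2 ⊢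
      rw [integral_add (integrable_mul_of_lp (Lp.memLp u) hp)
        (integrable_mul_of_lp (Lp.memLp v) hp),
        integral_add (integrable_mul_of_lp (coord_memLp (Lp.memLp g) i) hq)
        (integrable_mul_of_lp (coord_memLp (Lp.memLp k) i) hq), e1, e2]
      ring
    · have hx := integrable_Vplus_mul (V := V) (Lp.aestronglyMeasurable u)
        (Lp.aestronglyMeasurable v) h2 h4
      refine ((h2.add (hx.const_mul 2)).add h4).congr ?_
      filter_upwards [Lp.coeFn_add u v] with x hx
      simp only [Pi.add_apply, Prod.mk_add_mk] at hx ⊢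
      rw [hx]; ring
  smul_mem' := by
    rintro c ⟨u, g⟩ ⟨h1, h2⟩
    refine ⟨HasWeakGradient.congr (u := c • u) (g := c • g) ?_
      (Lp.coeFn_smul c u).symm (Lp.coeFn_smul c g).symm, ?_⟩
    · intro φ hφ hc i
      have e1 := h1 φ hφ hc i
      simp only [Pi.smul_apply, PiLp.smul_apply, smul_eq_mul, mul_assoc] at e1 ⊢
      rw [integral_const_mul, integral_const_mul, e1]
      ring
    · refine (h2.const_mul (c ^ 2)).congr ?_
      filter_upwards [Lp.coeFn_smul c u] with x hx
      simp only [Pi.smul_apply, Prod.smul_mk, smul_eq_mul] at hx ⊢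
      rw [hx]; ring

/-- The space `E = {u ∈ H¹(ℝ³) : ∫ (a |∇u|² + V⁺ u²) < ∞}`. The constant `a > 0` only enters
through the inner product below. -/
def EnergySpace (a : ℝ) (_ha : 0 < a) (V : C(R3, ℝ)) : Type := energySubmodule V

namespace EnergySpace

variable {a : ℝ} {ha : 0 < a} {V : C(R3, ℝ)}

instance : AddCommGroup (EnergySpace a ha V) :=
  inferInstanceAs (AddCommGroup (energySubmodule V))

instance : Module ℝ (EnergySpace a ha V) :=
  inferInstanceAs (Module ℝ (energySubmodule V))

/-- The function `u`. -/
def toFun (u : EnergySpace a ha V) : Lp ℝ 2 (volume : Measure R3) := u.1.1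

/-- The weak gradient `∇u`. -/
def grad (u : EnergySpace a ha V) : Lp R3 2 (volume : Measure R3) := u.1.2

lemma toFun_add (u v : EnergySpace a ha V) : (u + v).toFun = u.toFun + v.toFun := rfl
lemma grad_add (u v : EnergySpace a ha V) : (u + v).grad = u.grad + v.grad := rfl
lemma toFun_smul (c : ℝ) (u : EnergySpace a ha V) : (c • u).toFun = c • u.toFun := rfl
lemma grad_smul (c : ℝ) (u : EnergySpace a ha V) : (c • u).grad = c • u.grad := rfl

lemma hasWeakGradient (u : EnergySpace a ha V) : HasWeakGradient u.toFun u.grad := u.2.1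

lemma integrable_Vplus_sq (u : EnergySpace a ha V) :
    Integrable (fun x => Vplus V x * (u.toFun x) ^ 2) volume := u.2.2

lemma integrable_inner_grad (u v : EnergySpace a ha V) :
    Integrable (fun x => a * inner ℝ (u.grad x) (v.grad x)) volume :=
  (L2.integrable_inner (𝕜 := ℝ) u.grad v.grad).const_mul a

lemma integrable_inner (u v : EnergySpace a ha V) :
    Integrable (fun x => a * inner ℝ (u.grad x) (v.grad x)
      + Vplus V x * (u.toFun x * v.toFun x)) volume :=
  (integrable_inner_grad u v).add (integrable_Vplus_mul (Lp.aestronglyMeasurable _)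
    (Lp.aestronglyMeasurable _) u.integrable_Vplus_sq v.integrable_Vplus_sq)

/-- The inner product `⟨u, v⟩ = ∫ (a ∇u · ∇v + V⁺ u v)` on `E`. -/
@[reducible] def innerCore (a : ℝ) (ha : 0 < a) (V : C(R3, ℝ)) :
    InnerProductSpace.Core ℝ (EnergySpace a ha V) where
  inner u v := ∫ x, (a * inner ℝ (u.grad x) (v.grad x) + Vplus V x * (u.toFun x * v.toFun x))
  conj_inner_symm u v := by
    simp only [conj_trivial]
    refine integral_congr_ae (Eventually.of_forall fun x => ?_)
    simp only [real_inner_comm, mul_comm (u.toFun x)]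
  re_inner_nonneg u := by
    simp only [RCLike.re_to_real]
    refine integral_nonneg fun x => ?_
    exact add_nonneg (mul_nonneg ha.le real_inner_self_nonneg)
      (mul_nonneg (Vplus_nonneg V x) (mul_self_nonneg _))
  add_left u v w := by
    rw [← integral_add (integrable_inner u w) (integrable_inner v w)]
    refine integral_congr_ae ?_
    filter_upwards [Lp.coeFn_add u.toFun v.toFun, Lp.coeFn_add u.grad v.grad] with x h1 h2
    rw [toFun_add, grad_add, h1, h2]
    simp only [Pi.add_apply, inner_add_left]
    ring
  smul_left u v c := by
    simp only [conj_trivial]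
    rw [← integral_const_mul]
    refine integral_congr_ae ?_
    filter_upwards [Lp.coeFn_smul c u.toFun, Lp.coeFn_smul c u.grad] with x h1 h2
    rw [toFun_smul, grad_smul, h1, h2]
    simp only [Pi.smul_apply, real_inner_smul_left, smul_eq_mul]
    ring
  definite u hu := by
    have hnn : 0 ≤ᵐ[volume] fun x => a * inner ℝ (u.grad x) (u.grad x)
        + Vplus V x * (u.toFun x * u.toFun x) := Eventually.of_forall fun x =>
      add_nonneg (mul_nonneg ha.le real_inner_self_nonneg)
        (mul_nonneg (Vplus_nonneg V x) (mul_self_nonneg _))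
    have h0 := (integral_eq_zero_iff_of_nonneg_ae hnn (integrable_inner u u)).mp hu
    have hg : u.grad =ᵐ[volume] 0 := by
      filter_upwards [h0] with x hx
      have h1 : 0 ≤ a * inner ℝ (u.grad x) (u.grad x) :=
        mul_nonneg ha.le real_inner_self_nonneg
      have h2 : 0 ≤ Vplus V x * (u.toFun x * u.toFun x) :=
        mul_nonneg (Vplus_nonneg V x) (mul_self_nonneg _)
      simp only [Pi.zero_apply] at hx
      have h3 : a * inner ℝ (u.grad x) (u.grad x) = 0 := by linarith
      have h4 := (mul_eq_zero.mp h3).resolve_left ha.ne'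
      simpa using h4
    have hf := ae_eq_zero_of_weakGradient_zero (Lp.memLp u.toFun) hg u.hasWeakGradient
    refine Subtype.ext (Prod.ext ?_ ?_)
    · exact (Lp.eq_zero_iff_ae_eq_zero).mpr hf
    · exact (Lp.eq_zero_iff_ae_eq_zero).mpr hg

instance : NormedAddCommGroup (EnergySpace a ha V) := (innerCore a ha V).toNormedAddCommGroup

instance : InnerProductSpace ℝ (EnergySpace a ha V) :=
  InnerProductSpace.ofCore (innerCore a ha V).toCore

/-- The norm of `E` is `‖u‖ = (∫ (a |∇u|² + V⁺ u²))^{1/2}`. -/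
lemma norm_sq_eq (u : EnergySpace a ha V) :
    ‖u‖ ^ 2 = ∫ x, (a * ‖u.grad x‖ ^ 2 + Vplus V x * (u.toFun x) ^ 2) := by
  rw [← real_inner_self_eq_norm_sq]
  change (∫ x, (a * inner ℝ (u.grad x) (u.grad x)
    + Vplus V x * (u.toFun x * u.toFun x))) = _
  refine integral_congr_ae (Eventually.of_forall fun x => ?_)
  simp only [real_inner_self_eq_norm_sq, sq]

end EnergySpace

/-- The primitive `F(x, t) = ∫₀ᵗ f(x, s) ds`. -/
def primitive (f : R3 → ℝ → ℝ) (x : R3) (t : ℝ) : ℝ := ∫ s in (0 : ℝ)..t, f x s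

/-- The energy functional
`Φ(u) = ½ ∫ (a |∇u|² + V u²) + (b/4) (∫ |∇u|²)² - ∫ F(x, u)` on `E`. -/
def energy (a : ℝ) (ha : 0 < a) (b : ℝ) (V : C(R3, ℝ)) (f : R3 → ℝ → ℝ)
    (u : EnergySpace a ha V) : ℝ :=
  (1 / 2) * (∫ x, (a * ‖u.grad x‖ ^ 2 + V x * (u.toFun x) ^ 2))
    + (b / 4) * (∫ x, ‖u.grad x‖ ^ 2) ^ 2
    - ∫ x, primitive f x (u.toFun x)

/-- `(u n)` is a Cerami sequence of `Φ` at level `c`: `Φ(u n) → c` and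
`(1 + ‖u n‖) ‖Φ'(u n)‖ → 0`, with `Φ'` the Fréchet derivative and the norm of the dual. -/
def IsCeramiSeq {X : Type*} [NormedAddCommGroup X] [NormedSpace ℝ X]
    (Φ : X → ℝ) (c : ℝ) (u : ℕ → X) : Prop :=
  Tendsto (fun n => Φ (u n)) atTop (𝓝 c) ∧
    Tendsto (fun n => (1 + ‖u n‖) * ‖fderiv ℝ Φ (u n)‖) atTop (𝓝 0)

end Kirchhoff

end

noncomputable section

namespace Kirchhoff

open scoped ENNReal NNReal Convolution

/-! The argument is a uniform bound: if both `|Φ(u)|` and `|Φ'(u)u|` are at most `B`, then `‖u‖ ≤ R`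
with `R` independent of `u`. Along a Cerami sequence both quantities are bounded, because the weight
`1 + ‖u‖` dominates `‖u‖`.

In `4Φ(u) - Φ'(u)u` the nonlocal quartic terms cancel, and `4F ≤ t f` (from (f3)) gives `‖u‖² - ∫
V⁻u² ≤ 5B`. So if `‖u‖` is large, `∫ V⁻u² ≥ ½‖u‖²`. But `V⁻` is bounded and lives on `S = {V⁺ < M}`,
a set of finite measure, hence `∫_S u² ≥ d‖u‖²`. Together with the Sobolev bound `∫ u⁶ ≤ K‖u‖⁶` this
forces `|u| ≥ η‖u‖` on a subset of `S` of measure at least `κ`, with `η, κ` independent of `u`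
(`exists_measure_superlevel_ge`). On sets of finite measure the pointwise limit `F/t⁴ → ∞` is
uniform off a small set, so `∫ F(x,u) ≥ k‖u‖⁴` for any prescribed `k` once `‖u‖` is large
(`exists_integral_ge_of_superquartic`). Taking `k` above the coefficient `b/(4a²)` of the Kirchhoff
term sends `Φ(u)` below `-B`, a contradiction. No subsequence or weak limit is needed.

Two analytic inputs support this: the embedding of `E` into `L² ∩ L⁶`, from the Sobolev inequality
for weak gradients, and the Fréchet differentiability of `Φ`, which identifies `Φ'(u)u`. -/

/-! ### Sobolev inequality for weak gradients: mollification and cut-off -/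

/-- Young's inequality in `L²` for an average against a translate of a probability density. -/
lemma eLpNorm_two_le_of_enorm_le_average {X Y : Type*} [NormedAddCommGroup X]
    [NormedAddCommGroup Y] {ρ : R3 → ℝ} (hρ : Continuous ρ) (hρ1 : ∫⁻ x, ‖ρ x‖ₑ = 1)
    {g : R3 → X} (hg : AEStronglyMeasurable g volume) {A : R3 → Y}
    (hA : ∀ x, ‖A x‖ₑ ≤ ∫⁻ y, ‖ρ (x - y)‖ₑ * ‖g y‖ₑ) :
    eLpNorm A 2 volume ≤ eLpNorm g 2 volume := by
  have hρm : Measurable fun x => ‖ρ x‖ₑ := hρ.measurable.enorm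
  have hshift : ∀ x, ∫⁻ y, ‖ρ (x - y)‖ₑ = 1 := fun x => by
    rw [lintegral_sub_left_eq_self (fun y => ‖ρ y‖ₑ) x, hρ1]
  have hsq : ∀ x, ‖A x‖ₑ ^ (2 : ℝ) ≤ ∫⁻ y, ‖ρ (x - y)‖ₑ * ‖g y‖ₑ ^ (2 : ℝ) := by
    intro x
    have hm : AEMeasurable (fun y => ‖ρ (x - y)‖ₑ) volume :=
      (hρm.comp (measurable_const.sub measurable_id)).aemeasurable
    -- Cauchy–Schwarz with the factors `ρ^{1/2}` and `(ρ|g|²)^{1/2}`; since `ρ` has mass one,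
    -- squaring gives Jensen's inequality.
    have key := ENNReal.lintegral_mul_norm_pow_le (μ := (volume : Measure R3)) (p := 1 / 2)
      (q := 1 / 2) hm (hm.mul (hg.enorm.pow_const (2 : ℝ)))
      (by norm_num) (by norm_num) (by norm_num)
    rw [hshift, ENNReal.one_rpow, one_mul] at key
    have e : ∀ y, ‖ρ (x - y)‖ₑ ^ (1 / 2 : ℝ) * (‖ρ (x - y)‖ₑ * ‖g y‖ₑ ^ (2 : ℝ)) ^ (1 / 2 : ℝ)
        = ‖ρ (x - y)‖ₑ * ‖g y‖ₑ := by
      intro y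
      rw [ENNReal.mul_rpow_of_nonneg _ _ (by norm_num), ← ENNReal.rpow_mul, ← mul_assoc,
        ← ENNReal.rpow_add_of_nonneg _ _ (by norm_num) (by norm_num)]
      norm_num
    simp only [Pi.mul_apply, e] at key
    calc ‖A x‖ₑ ^ (2 : ℝ) ≤ ((∫⁻ y, ‖ρ (x - y)‖ₑ * ‖g y‖ₑ ^ (2 : ℝ)) ^ (1 / 2 : ℝ)) ^ (2 : ℝ) :=
          ENNReal.rpow_le_rpow ((hA x).trans key) (by norm_num)
      _ = _ := by rw [← ENNReal.rpow_mul]; norm_num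
  rw [eLpNorm_eq_lintegral_rpow_enorm_toReal (by norm_num) (by norm_num),
    eLpNorm_eq_lintegral_rpow_enorm_toReal (by norm_num) (by norm_num)]
  simp only [ENNReal.toReal_ofNat]
  refine ENNReal.rpow_le_rpow ?_ (by norm_num)
  calc ∫⁻ x, ‖A x‖ₑ ^ (2 : ℝ) ≤ ∫⁻ x, ∫⁻ y, ‖ρ (x - y)‖ₑ * ‖g y‖ₑ ^ (2 : ℝ) :=
        lintegral_mono hsq
    _ = ∫⁻ y, ∫⁻ x, ‖ρ (x - y)‖ₑ * ‖g y‖ₑ ^ (2 : ℝ) := by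
        refine lintegral_lintegral_swap ?_
        refine ((hρm.comp (measurable_fst.sub measurable_snd)).aemeasurable).mul ?_
        exact (hg.enorm.pow_const (2 : ℝ)).comp_quasiMeasurePreserving
          Measure.quasiMeasurePreserving_snd
    _ = ∫⁻ y, ‖g y‖ₑ ^ (2 : ℝ) := by
        refine lintegral_congr fun y => ?_
        have hm : AEMeasurable (fun x => ‖ρ (x - y)‖ₑ) volume :=
          (hρm.comp (measurable_id.sub measurable_const)).aemeasurable
        rw [lintegral_mul_const'' _ hm,
          lintegral_sub_right_eq_self (fun x => ‖ρ x‖ₑ) y, hρ1, one_mul]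

/-- Convolution with a test function moves the derivative onto the weak gradient. -/
lemma HasWeakGradient.fderiv_convolution {u : R3 → ℝ} {g : R3 → R3} (h : HasWeakGradient u g)
    (hu : MemLp u 2 volume) (hg : MemLp g 2 volume) {ρ : R3 → ℝ} (hρ : ContDiff ℝ ∞ ρ)
    (hc : HasCompactSupport ρ) (x : R3) :
    fderiv ℝ (ρ ⋆[ContinuousLinearMap.lsmul ℝ ℝ, volume] u) x
      = innerSL ℝ (∫ y, ρ (x - y) • g y) := by
  have hloc : LocallyIntegrable u volume := hu.locallyIntegrable (by norm_num)
  have hd := hc.hasFDerivAt_convolution_left (ContinuousLinearMap.lsmul ℝ ℝ)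
    (μ := (volume : Measure R3)) (hρ.of_le (by norm_cast)) hloc x
  have hρx : ContDiff ℝ ∞ fun y => ρ (x - y) := hρ.comp (contDiff_const.sub contDiff_id)
  have hcx : HasCompactSupport fun y => ρ (x - y) := hc.comp_homeomorph (Homeomorph.subLeft x)
  have hint : Integrable (fun y => ρ (x - y) • g y) volume :=
    (hg.locallyIntegrable (by norm_num)).integrable_smul_left_of_hasCompactSupport
      hρx.continuous hcx
  rw [hd.fderiv]
  refine ContinuousLinearMap.coe_injective ((EuclideanSpace.basisFun (Fin 3) ℝ).toBasis.ext
    fun i => ?_)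
  have hfd : ∀ y, fderiv ℝ (fun y => ρ (x - y)) y (EuclideanSpace.single i 1)
      = - fderiv ℝ ρ (x - y) (EuclideanSpace.single i 1) := by
    intro y
    have h1 : HasFDerivAt (fun y : R3 => x - y) (-(ContinuousLinearMap.id ℝ R3)) y :=
      (hasFDerivAt_id y).const_sub x
    have h2 := ((hρ.differentiable (by simp)) (x - y)).hasFDerivAt.comp y h1
    rw [show (fun y => ρ (x - y)) = ρ ∘ fun y => x - y from rfl, h2.fderiv]
    simp
  -- The test function is the reflected kernel `y ↦ ρ(x - y)`; the sign from the reflection cancels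
  -- the sign of integration by parts.
  have hw := h _ hρx hcx i
  simp only [hfd, mul_neg, integral_neg, neg_inj] at hw
  simp only [OrthonormalBasis.coe_toBasis, EuclideanSpace.basisFun_apply,
    ContinuousLinearMap.coe_coe]
  have hR : (innerSL ℝ (∫ y, ρ (x - y) • g y)) (EuclideanSpace.single i (1 : ℝ))
      = ∫ y, g y i * ρ (x - y) := by
    rw [innerSL_apply_apply, real_inner_comm, EuclideanSpace.inner_single_left]
    have := ((EuclideanSpace.proj (𝕜 := ℝ) i).integral_comp_comm hint)
    rw [show (∫ y, ρ (x - y) • g y) i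
      = EuclideanSpace.proj (𝕜 := ℝ) i (∫ y, ρ (x - y) • g y) from rfl, ← this]
    simp [mul_comm]
  rw [hR, ← hw, convolution_eq_swap]
  have hi : Integrable (fun t => ((ContinuousLinearMap.lsmul ℝ ℝ).precompL R3)
      (fderiv ℝ ρ (x - t)) (u t)) volume := by
    have hcd : HasCompactSupport (fderiv ℝ ρ) := hc.fderiv ℝ
    have := hcd.convolutionExists_left ((ContinuousLinearMap.lsmul ℝ ℝ).precompL R3)
      (μ := (volume : Measure R3)) (hρ.continuous_fderiv (by simp)) hloc x
    exact this.integrable_swap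
  rw [ContinuousLinearMap.integral_apply hi]
  refine integral_congr_ae (Eventually.of_forall fun y => ?_)
  simp [ContinuousLinearMap.precompL_apply, mul_comm]

/-- A function in `H¹` is an a.e. limit of `C¹` functions with controlled norms. -/
lemma HasWeakGradient.exists_mollification {u : R3 → ℝ} {g : R3 → R3} (h : HasWeakGradient u g)
    (hu : MemLp u 2 volume) (hg : MemLp g 2 volume) : ∃ m : ℕ → R3 → ℝ,
      (∀ n, ContDiff ℝ 1 (m n)) ∧ (∀ n, eLpNorm (m n) 2 volume ≤ eLpNorm u 2 volume) ∧
      (∀ n, eLpNorm (fderiv ℝ (m n)) 2 volume ≤ eLpNorm g 2 volume) ∧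
      ∀ᵐ x ∂(volume : Measure R3), Tendsto (fun n => m n x) atTop (𝓝 (u x)) := by
  have hloc : LocallyIntegrable u volume := hu.locallyIntegrable (by norm_num)
  let φ : ℕ → ContDiffBump (0 : R3) := fun n =>
    -- Outer radius at most twice the inner one: the bounded ratio `K = 2` is what a.e. convergence
    -- of the mollifications requires.
    ⟨1 / (n + 1) / 2, 1 / (n + 1), by positivity, half_lt_self (by positivity)⟩
  let ρ : ℕ → R3 → ℝ := fun n => (φ n).normed volume
  have hρs : ∀ n, ContDiff ℝ ∞ (ρ n) := fun n => (φ n).contDiff_normed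
  have hρc : ∀ n, HasCompactSupport (ρ n) := fun n => (φ n).hasCompactSupport_normed
  have hρ1 : ∀ n, ∫⁻ x, ‖ρ n x‖ₑ = 1 := fun n => by
    have h1 := ofReal_integral_eq_lintegral_ofReal ((φ n).integrable_normed (μ := volume))
      (Eventually.of_forall (φ n).nonneg_normed)
    rw [(φ n).integral_normed, ENNReal.ofReal_one] at h1
    rw [h1]
    exact lintegral_congr fun x => Real.enorm_of_nonneg ((φ n).nonneg_normed x)
  let m : ℕ → R3 → ℝ := fun n => ρ n ⋆[ContinuousLinearMap.lsmul ℝ ℝ, volume] u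
  have hms : ∀ n, ContDiff ℝ 1 (m n) := fun n =>
    (hρc n).contDiff_convolution_left (n := 1) _ ((hρs n).of_le (by norm_cast)) hloc
  have hm2 : ∀ n, eLpNorm (m n) 2 volume ≤ eLpNorm u 2 volume := fun n => by
    refine eLpNorm_two_le_of_enorm_le_average (hρs n).continuous (hρ1 n) hu.1 fun x => ?_
    simp only [m, convolution_eq_swap]
    refine (enorm_integral_le_lintegral_enorm _).trans_eq (lintegral_congr fun y => ?_)
    simp [enorm_mul]
  have hmd : ∀ n, eLpNorm (fderiv ℝ (m n)) 2 volume ≤ eLpNorm g 2 volume := fun n => by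
    refine eLpNorm_two_le_of_enorm_le_average (hρs n).continuous (hρ1 n) hg.1 fun x => ?_
    rw [h.fderiv_convolution hu hg (hρs n) (hρc n)]
    rw [← ofReal_norm, innerSL_apply_norm, ofReal_norm]
    refine (enorm_integral_le_lintegral_enorm _).trans_eq (lintegral_congr fun y => ?_)
    rw [enorm_smul]
  have hmt : ∀ᵐ x ∂(volume : Measure R3), Tendsto (fun n => m n x) atTop (𝓝 (u x)) := by
    refine ContDiffBump.ae_convolution_tendsto_right_of_locallyIntegrable (K := 2) (φ := φ) ?_
      (Eventually.of_forall fun n => ?_) hloc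
    · exact tendsto_one_div_add_atTop_nhds_zero_nat
    · simp only [φ]; linarith
  exact ⟨m, hms, hm2, hmd, hmt⟩

/-- Smooth cut-off functions exhausting `ℝ³`, with gradients tending to zero uniformly. -/
lemma exists_cutoff : ∃ (χ : ℕ → R3 → ℝ) (d : ℕ → ℝ), (∀ n, ContDiff ℝ 1 (χ n)) ∧
    (∀ n, HasCompactSupport (χ n)) ∧ (∀ n x, ‖χ n x‖ ≤ 1) ∧ (∀ n x, ‖fderiv ℝ (χ n) x‖ ≤ d n) ∧
    Tendsto d atTop (𝓝 0) ∧ ∀ x, Tendsto (fun n => χ n x) atTop (𝓝 1) := by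
  let χ : ContDiffBump (0 : R3) := ⟨1, 2, one_pos, by norm_num⟩
  let c : ℕ → ℝ := fun n => 1 / ((n : ℝ) + 1)
  have hc0 : ∀ n, 0 < c n := fun n => by positivity
  have hct : Tendsto c atTop (𝓝 0) := tendsto_one_div_add_atTop_nhds_zero_nat
  obtain ⟨D, hD⟩ := (χ.contDiff (n := 1).continuous_fderiv
    (by simp)).bounded_above_of_compact_support (χ.hasCompactSupport.fderiv ℝ)
  -- Dilates of one bump function: the gradient scales by `c n = 1/(n+1)`.
  refine ⟨fun n x => χ (c n • x), fun n => c n * D, fun n =>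
    χ.contDiff.comp (contDiff_id.const_smul (c n)), fun n => χ.hasCompactSupport.comp_homeomorph
      (Homeomorph.smulOfNeZero (c n) (hc0 n).ne'), fun n x => ?_, fun n x => ?_, ?_, fun x => ?_⟩
  · rw [Real.norm_of_nonneg χ.nonneg]
    exact χ.le_one
  · rw [fderiv_comp_smul, norm_smul, Real.norm_of_nonneg (hc0 n).le]
    exact mul_le_mul_of_nonneg_left (hD _) (hc0 n).le
  · simpa using hct.mul_const D
  · have h2 : Tendsto (fun n => χ (c n • x)) atTop (𝓝 (χ ((0 : ℝ) • x))) :=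
      (χ.continuous.tendsto _).comp (hct.smul_const x)
    rwa [zero_smul, χ.one_of_mem_closedBall (by simp [χ])] at h2

/-- Product rule. The error term carries the factor `d`, which tends to zero along the cut-offs. -/
lemma eLpNorm_fderiv_mul_le {χ m : R3 → ℝ} (hχ : ContDiff ℝ 1 χ) (hm : ContDiff ℝ 1 m) {d : ℝ}
    (hχ1 : ∀ x, ‖χ x‖ ≤ 1) (hχd : ∀ x, ‖fderiv ℝ χ x‖ ≤ d) :
    eLpNorm (fderiv ℝ fun x => χ x * m x) 2 volume
      ≤ eLpNorm (fderiv ℝ m) 2 volume + ENNReal.ofReal d * eLpNorm m 2 volume := by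
  have heq : fderiv ℝ (fun x => χ x * m x)
      = (fun x => χ x • fderiv ℝ m x) + fun x => m x • fderiv ℝ χ x := by
    funext x
    exact fderiv_fun_mul (hχ.differentiable one_ne_zero x) (hm.differentiable one_ne_zero x)
  have hmc := hm.continuous_fderiv one_ne_zero
  have hcc := hχ.continuous_fderiv one_ne_zero
  have h1 : AEStronglyMeasurable (fun x => χ x • fderiv ℝ m x) volume :=
    (hχ.continuous.smul hmc).aestronglyMeasurable
  have h2 : AEStronglyMeasurable (fun x => m x • fderiv ℝ χ x) volume :=
    (hm.continuous.smul hcc).aestronglyMeasurable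
  rw [heq]
  refine (eLpNorm_add_le h1 h2 (by norm_num)).trans (add_le_add ?_ ?_)
  · refine eLpNorm_mono fun x => ?_
    rw [norm_smul]
    exact mul_le_of_le_one_left (norm_nonneg _) (hχ1 x)
  · refine eLpNorm_le_mul_eLpNorm_of_ae_le_mul (Eventually.of_forall fun x => ?_) 2
    rw [norm_smul, mul_comm]
    exact mul_le_mul_of_nonneg_right (hχd x) (norm_nonneg _)

/-- **Sobolev inequality** on `ℝ³`: `‖u‖_6 ≤ C ‖∇u‖_2` for `u ∈ H¹`. -/
theorem exists_eLpNorm_six_le : ∃ C : ℝ≥0, ∀ (u : R3 → ℝ) (g : R3 → R3),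
    MemLp u 2 volume → MemLp g 2 volume → HasWeakGradient u g →
      eLpNorm u 6 volume ≤ C * eLpNorm g 2 volume := by
  obtain ⟨C, hC⟩ : ∃ C : ℝ≥0, ∀ w : R3 → ℝ, ContDiff ℝ 1 w → HasCompactSupport w →
      eLpNorm w 6 volume ≤ C * eLpNorm (fderiv ℝ w) 2 volume := by
    refine ⟨eLpNormLESNormFDerivOfEqInnerConst (volume : Measure R3) 2, fun w hw hc => ?_⟩
    have := eLpNorm_le_eLpNorm_fderiv_of_eq_inner (volume : Measure R3) hw hc (p := 2) (p' := 6)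
      (by norm_num) (by simp) (by simp; norm_num)
    simpa using this
  refine ⟨C, fun u g hu hg h => ?_⟩
  obtain ⟨m, hms, hm2, hmd, hmt⟩ := h.exists_mollification hu hg
  obtain ⟨χ, d, hχs, hχc, hχ1, hχd, hd, hχt⟩ := exists_cutoff
  let w : ℕ → R3 → ℝ := fun n x => χ n x * m n x
  have hws : ∀ n, ContDiff ℝ 1 (w n) := fun n => (hχs n).mul (hms n)
  have hwc : ∀ n, HasCompactSupport (w n) := fun n => (hχc n).mul_right
  have hwt : ∀ᵐ x ∂(volume : Measure R3), Tendsto (fun n => w n x) atTop (𝓝 (u x)) := by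
    filter_upwards [hmt] with x hx
    simpa using (hχt x).mul hx
  have hwd : ∀ n, eLpNorm (fderiv ℝ (w n)) 2 volume
      ≤ eLpNorm g 2 volume + ENNReal.ofReal (d n) * eLpNorm u 2 volume := fun n =>
    (eLpNorm_fderiv_mul_le (hχs n) (hms n) (hχ1 n) (hχd n)).trans
      (add_le_add (hmd n) (mul_le_mul_right (hm2 n) _))
  have hlim : Tendsto (fun n => (C : ℝ≥0∞) * (eLpNorm g 2 volume
      + ENNReal.ofReal (d n) * eLpNorm u 2 volume)) atTop
      (𝓝 (C * (eLpNorm g 2 volume + ENNReal.ofReal 0 * eLpNorm u 2 volume))) :=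
    ENNReal.Tendsto.const_mul (Tendsto.const_add _ (ENNReal.Tendsto.mul_const
      (ENNReal.tendsto_ofReal hd) (Or.inr hu.2.ne))) (Or.inr ENNReal.coe_ne_top)
  rw [ENNReal.ofReal_zero, zero_mul, add_zero] at hlim
  -- Fatou: the truncated mollifications converge a.e. to `u`, and the classical inequality bounds
  -- their `L⁶` norms by a sequence tending to `C‖g‖₂`.
  refine (Lp.eLpNorm_lim_le_liminf_eLpNorm
    (fun n => (hws n).continuous.aestronglyMeasurable) u hwt).trans ?_
  rw [← hlim.liminf_eq]
  exact liminf_le_liminf (Eventually.of_forall fun n =>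
    (hC _ (hws n) (hwc n)).trans (mul_le_mul_right (hwd n) _))

/-! ### Embeddings of the energy space into `L⁶` and `L²` -/

namespace EnergySpace

variable {a : ℝ} {ha : 0 < a} {V : C(R3, ℝ)}

lemma integrable_sq (u : EnergySpace a ha V) : Integrable (fun x => u.toFun x ^ 2) volume :=
  (Lp.memLp u.toFun).integrable_sq

lemma integrable_norm_grad_sq (u : EnergySpace a ha V) :
    Integrable (fun x => ‖u.grad x‖ ^ 2) volume := by
  have := (Lp.memLp u.grad).norm.integrable_sq
  exact this

lemma integral_norm_grad_sq (u : EnergySpace a ha V) :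
    ∫ x, ‖u.grad x‖ ^ 2 = ‖u.grad‖ ^ 2 := by
  rw [← real_inner_self_eq_norm_sq, L2.inner_def]
  simp only [real_inner_self_eq_norm_sq]

lemma norm_sq_eq_add (u : EnergySpace a ha V) :
    ‖u‖ ^ 2 = a * ‖u.grad‖ ^ 2 + ∫ x, Vplus V x * u.toFun x ^ 2 := by
  rw [norm_sq_eq, integral_add (u.integrable_norm_grad_sq.const_mul a) u.integrable_Vplus_sq,
    integral_const_mul, integral_norm_grad_sq]

lemma integral_Vplus_sq_nonneg (u : EnergySpace a ha V) :
    0 ≤ ∫ x, Vplus V x * u.toFun x ^ 2 :=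
  integral_nonneg fun x => mul_nonneg (Vplus_nonneg V x) (sq_nonneg _)

lemma norm_grad_sq_le (u : EnergySpace a ha V) : ‖u.grad‖ ^ 2 ≤ ‖u‖ ^ 2 / a := by
  rw [le_div_iff₀ ha, norm_sq_eq_add]
  linarith [u.integral_Vplus_sq_nonneg]

/-- The embedding of the energy space into `L⁶`. -/
lemma exists_integral_pow_six_le (a : ℝ) (ha : 0 < a) (V : C(R3, ℝ)) : ∃ K : ℝ, 0 ≤ K ∧
    ∀ u : EnergySpace a ha V, Integrable (fun x => u.toFun x ^ 6) volume ∧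
      ∫ x, u.toFun x ^ 6 ≤ K * ‖u‖ ^ 6 := by
  obtain ⟨C, hC⟩ := exists_eLpNorm_six_le
  refine ⟨(C : ℝ) ^ 6 / a ^ 3, by positivity, fun u => ?_⟩
  have hS := hC u.toFun u.grad (Lp.memLp _) (Lp.memLp _) u.hasWeakGradient
  have hfin : (C : ENNReal) * eLpNorm u.grad 2 volume ≠ ⊤ :=
    ENNReal.mul_ne_top ENNReal.coe_ne_top (Lp.memLp u.grad).2.ne
  have hm : MemLp u.toFun 6 volume :=
    ⟨Lp.aestronglyMeasurable _, hS.trans_lt (lt_top_iff_ne_top.mpr hfin)⟩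
  have heven : ∀ x, ‖u.toFun x‖ ^ 6 = u.toFun x ^ 6 := fun x =>
    (show Even 6 by decide).pow_abs _
  have hint : Integrable (fun x => u.toFun x ^ 6) volume := by
    simpa only [heven] using hm.integrable_norm_pow (p := 6) (by norm_num)
  refine ⟨hint, ?_⟩
  have h1 : (eLpNorm u.toFun 6 volume).toReal ≤ C * ‖u.grad‖ := by
    have := ENNReal.toReal_mono hfin hS
    rwa [ENNReal.toReal_mul, ENNReal.coe_toReal, ← Lp.norm_def] at this
  have h0 : 0 ≤ ∫ x, u.toFun x ^ 6 := integral_nonneg fun x => by positivity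
  have h2 : ∫ x, u.toFun x ^ 6 = (eLpNorm u.toFun 6 volume).toReal ^ 6 := by
    rw [hm.eLpNorm_eq_integral_rpow_norm (by norm_num) (by norm_num)]
    have : ∀ x, ‖u.toFun x‖ ^ (6 : ENNReal).toReal = u.toFun x ^ 6 := fun x => by
      rw [← heven, ENNReal.toReal_ofNat]
      exact_mod_cast Real.rpow_natCast ‖u.toFun x‖ 6
    simp only [this]
    rw [ENNReal.toReal_ofReal (Real.rpow_nonneg h0 _), ENNReal.toReal_ofNat,
      ← Real.rpow_natCast, ← Real.rpow_mul h0]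
    norm_num
  calc ∫ x, u.toFun x ^ 6 ≤ (C * ‖u.grad‖) ^ 6 := by
        rw [h2]; exact pow_le_pow_left₀ ENNReal.toReal_nonneg h1 6
    _ = C ^ 6 * (‖u.grad‖ ^ 2) ^ 3 := by ring
    _ ≤ C ^ 6 * (‖u‖ ^ 2 / a) ^ 3 := by
        gcongr
        exact u.norm_grad_sq_le
    _ = (C : ℝ) ^ 6 / a ^ 3 * ‖u‖ ^ 6 := by field_simp

/-- The embedding of the energy space into `L²`, when a sublevel set of `V⁺` has finite
measure. -/
lemma exists_integral_sq_le (a : ℝ) (ha : 0 < a) (V : C(R3, ℝ)) {M : ℝ} (hM : 0 < M)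
    (hS : volume {x | Vplus V x < M} < ⊤) : ∃ K : ℝ, 0 ≤ K ∧
    ∀ u : EnergySpace a ha V, ∫ x, u.toFun x ^ 2 ≤ K * ‖u‖ ^ 2 := by
  obtain ⟨K, hK0, hK⟩ := exists_integral_pow_six_le a ha V
  set S : Set R3 := {x | Vplus V x < M} with hSdef
  have hSm : MeasurableSet S := measurableSet_lt (continuous_Vplus V).measurable measurable_const
  refine ⟨1 / M + (volume.real S + K), by positivity, fun u => ?_⟩
  rcases eq_or_ne u 0 with rfl | hne
  · have h0 : ∫ x, (0 : EnergySpace a ha V).toFun x ^ 2 = 0 := by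
      refine integral_eq_zero_of_ae ?_
      filter_upwards [Lp.coeFn_zero ℝ 2 (volume : Measure R3)] with x hx
      have : (0 : EnergySpace a ha V).toFun x = 0 := hx
      simp [this]
    rw [h0, norm_zero]; simp
  have hl : 0 < ‖u‖ := norm_pos_iff.mpr hne
  have hind : Integrable (S.indicator fun _ => (1 : ℝ)) volume :=
    (integrable_indicator_iff hSm).mpr (integrableOn_const hS.ne)
  -- Off `S` one has `V⁺ ≥ M`. On `S` split at the level `|u| = ‖u‖`, above which `u² ≤ u⁶/‖u‖⁴`.
  -- This level makes every term, once integrated, at most a constant times `‖u‖²`.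
  have hpt : ∀ x, u.toFun x ^ 2 ≤ 1 / M * (Vplus V x * u.toFun x ^ 2)
      + (‖u‖ ^ 2 * S.indicator (fun _ => (1 : ℝ)) x + 1 / ‖u‖ ^ 4 * u.toFun x ^ 6) := by
    intro x
    have hV0 := Vplus_nonneg V x
    by_cases hx : x ∈ S
    · rw [Set.indicator_of_mem hx, mul_one]
      have h1 : 0 ≤ 1 / M * (Vplus V x * u.toFun x ^ 2) := by positivity
      have h2 : u.toFun x ^ 2 ≤ ‖u‖ ^ 2 + 1 / ‖u‖ ^ 4 * u.toFun x ^ 6 := by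
        rcases le_total (u.toFun x ^ 2) (‖u‖ ^ 2) with h | h
        · have : 0 ≤ 1 / ‖u‖ ^ 4 * u.toFun x ^ 6 := by positivity
          linarith
        · have h3 : (‖u‖ ^ 2) ^ 2 ≤ (u.toFun x ^ 2) ^ 2 := pow_le_pow_left₀ (by positivity) h 2
          have h4 : u.toFun x ^ 2 ≤ 1 / ‖u‖ ^ 4 * u.toFun x ^ 6 := by
            rw [one_div, inv_mul_eq_div, le_div_iff₀ (by positivity)]
            calc u.toFun x ^ 2 * ‖u‖ ^ 4 = u.toFun x ^ 2 * (‖u‖ ^ 2) ^ 2 := by ring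
              _ ≤ u.toFun x ^ 2 * (u.toFun x ^ 2) ^ 2 := by gcongr
              _ = _ := by ring
          have := sq_nonneg ‖u‖
          linarith
      linarith
    · rw [Set.indicator_of_notMem hx, mul_zero, zero_add]
      have hMV : M ≤ Vplus V x := not_lt.mp hx
      have h1 : u.toFun x ^ 2 ≤ 1 / M * (Vplus V x * u.toFun x ^ 2) := by
        rw [one_div, inv_mul_eq_div, le_div_iff₀ hM, mul_comm]
        exact mul_le_mul_of_nonneg_right hMV (sq_nonneg _)
      have : 0 ≤ 1 / ‖u‖ ^ 4 * u.toFun x ^ 6 := by positivity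
      linarith
  have hi1 := u.integrable_Vplus_sq.const_mul (1 / M)
  have hi2 := hind.const_mul (‖u‖ ^ 2)
  have hi3 := (hK u).1.const_mul (1 / ‖u‖ ^ 4)
  have hi23 : Integrable (fun x => ‖u‖ ^ 2 * S.indicator (fun _ => (1 : ℝ)) x
      + 1 / ‖u‖ ^ 4 * u.toFun x ^ 6) volume := hi2.add hi3
  have hle := integral_mono u.integrable_sq (hi1.add hi23) hpt
  have e1 : ∫ x, (1 / M * (Vplus V x * u.toFun x ^ 2)
      + (‖u‖ ^ 2 * S.indicator (fun _ => (1 : ℝ)) x + 1 / ‖u‖ ^ 4 * u.toFun x ^ 6))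
      = 1 / M * (∫ x, Vplus V x * u.toFun x ^ 2) + (‖u‖ ^ 2 * volume.real S
        + 1 / ‖u‖ ^ 4 * ∫ x, u.toFun x ^ 6) := by
    have e2 : ∫ x, S.indicator (fun _ => (1 : ℝ)) x = volume.real S := by
      rw [integral_indicator hSm]; simp
    rw [integral_add hi1 hi23, integral_add hi2 hi3, integral_const_mul,
      integral_const_mul, integral_const_mul, e2]
  have h6 : 1 / ‖u‖ ^ 4 * ∫ x, u.toFun x ^ 6 ≤ K * ‖u‖ ^ 2 := by
    calc 1 / ‖u‖ ^ 4 * ∫ x, u.toFun x ^ 6 ≤ 1 / ‖u‖ ^ 4 * (K * ‖u‖ ^ 6) := by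
          gcongr; exact (hK u).2
      _ = _ := by field_simp
  have h7 : ∫ x, Vplus V x * u.toFun x ^ 2 ≤ ‖u‖ ^ 2 := by
    rw [norm_sq_eq_add u]
    have : 0 ≤ a * ‖u.grad‖ ^ 2 := by positivity
    linarith
  have h8 : 1 / M * (∫ x, Vplus V x * u.toFun x ^ 2) ≤ 1 / M * ‖u‖ ^ 2 := by gcongr
  calc ∫ x, u.toFun x ^ 2 ≤ _ := hle
    _ = _ := e1
    _ ≤ _ := by linarith

end EnergySpace

/-! ### Superposition integrals: first-order expansion in `L² ∩ L⁶` -/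

/-- Continuous nonlinearities with `|g(x, t)| ≤ C (|t| + |t|⁵)`. -/
structure IsSobolevGrowth (g : R3 → ℝ → ℝ) (C : ℝ) : Prop where
  continuous : Continuous (Function.uncurry g)
  nonneg : 0 ≤ C
  bound : ∀ x t, |g x t| ≤ C * (|t| + |t| ^ 5)

/-- The oscillation of `g(x, ·)` on the interval of relative radius `δ` around `t`. -/
def relOsc (g : R3 → ℝ → ℝ) (δ : ℝ) (x : R3) (t : ℝ) : ℝ :=
  sSup ((fun s : ℝ => |g x (t + δ * s * t) - g x t|) '' Set.Icc (-1) 1)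

/-- Replace the smaller of `s`, `k` by the larger. This stands in for Hölder's inequality when
pairing `g(x, u)` with `h`. -/
lemma add_pow_five_mul_le {s k : ℝ} (hs : 0 ≤ s) (hk : 0 ≤ k) :
    (s + s ^ 5) * k ≤ (s ^ 2 + s ^ 6) + (k ^ 2 + k ^ 6) := by
  rcases le_total k s with h | h
  · have : (s + s ^ 5) * k ≤ (s + s ^ 5) * s := by gcongr
    have h2 : 0 ≤ k ^ 2 + k ^ 6 := by positivity
    nlinarith
  · have : (s + s ^ 5) * k ≤ (k + k ^ 5) * k := by gcongr
    have h2 : 0 ≤ s ^ 2 + s ^ 6 := by positivity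
    nlinarith

/-- A substitute for Young's inequality that gains a small factor on `k`. -/
lemma mul_le_of_le_add_pow_five {A τ w s k : ℝ} (hA : 0 ≤ A) (hτ : 0 < τ) (hw : 0 ≤ w)
    (hs : 0 ≤ s) (hk : 0 ≤ k) (hws : w ≤ A * (s + s ^ 5)) :
    w * k ≤ τ * (k ^ 2 + k ^ 6) + (1 + A / τ) * (w * s) := by
  -- Chosen so that `c ≥ 1` and `A ≤ τc`. If `k ≤ cs` then `wk ≤ c·ws`; otherwise `cs ≤ k` and `cs⁵
  -- ≤ k⁵`, so `w ≤ τ(k + k⁵)`.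
  set c := 1 + A / τ with hc
  have hc1 : 1 ≤ c := by rw [hc]; have : 0 ≤ A / τ := by positivity
                         linarith
  have hAc : A ≤ τ * c := by rw [hc, mul_add, mul_div_cancel₀ _ hτ.ne']; linarith
  rcases le_total k (c * s) with h | h
  · have h1 : w * k ≤ w * (c * s) := by gcongr
    have h2 : 0 ≤ τ * (k ^ 2 + k ^ 6) := by positivity
    nlinarith
  · have h3 : c * s ^ 5 ≤ k ^ 5 := by
      calc c * s ^ 5 ≤ c ^ 5 * s ^ 5 := by
            gcongr; exact le_self_pow₀ hc1 (by norm_num)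
        _ = (c * s) ^ 5 := by ring
        _ ≤ k ^ 5 := by gcongr
    have h4 : w ≤ τ * (k + k ^ 5) := by
      calc w ≤ A * (s + s ^ 5) := hws
        _ ≤ τ * c * (s + s ^ 5) := by gcongr
        _ = τ * (c * s + c * s ^ 5) := by ring
        _ ≤ τ * (k + k ^ 5) := by gcongr
    have h5 : w * k ≤ τ * (k + k ^ 5) * k := by gcongr
    have h6 : 0 ≤ c * (w * s) := by positivity
    nlinarith

lemma relOsc_zero (g : R3 → ℝ → ℝ) (x : R3) (t : ℝ) : relOsc g 0 x t = 0 := by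
  unfold relOsc
  simp only [zero_mul, add_zero, sub_self, abs_zero]
  rw [Set.Nonempty.image_const ⟨0, by norm_num⟩, csSup_singleton]

lemma relOsc_nonneg (g : R3 → ℝ → ℝ) (δ : ℝ) (x : R3) (t : ℝ) : 0 ≤ relOsc g δ x t :=
  Real.sSup_nonneg (by rintro _ ⟨s, -, rfl⟩; exact abs_nonneg _)

namespace IsSobolevGrowth

variable {g : R3 → ℝ → ℝ} {C : ℝ} (hg : IsSobolevGrowth g C)
include hg

lemma continuous_right (x : R3) : Continuous (g x) :=
  hg.continuous.comp (Continuous.prodMk_right x)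

lemma continuous_primitive : Continuous fun z : R3 × ℝ => primitive g z.1 z.2 :=
  intervalIntegral.continuous_parametric_primitive_of_continuous hg.continuous

lemma abs_primitive_le (x : R3) (t : ℝ) : |primitive g x t| ≤ C * (t ^ 2 + t ^ 6) := by
  have h : ∀ s ∈ Set.uIoc 0 t, ‖g x s‖ ≤ C * (|t| + |t| ^ 5) := fun s hs => by
    have hst : |s| ≤ |t| := by simpa using Set.abs_sub_left_of_mem_uIcc (Set.uIoc_subset_uIcc hs)
    refine (hg.bound x s).trans ?_
    have := hg.nonneg
    gcongr
  have := intervalIntegral.norm_integral_le_of_norm_le_const h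
  rw [sub_zero, Real.norm_eq_abs] at this
  refine this.trans_eq ?_
  rw [← sq_abs t, ← (show Even 6 by decide).pow_abs t]; ring

lemma relOsc_le {δ : ℝ} (hδ : 0 ≤ δ) (hδ1 : δ ≤ 1) (x : R3) (t : ℝ) :
    relOsc g δ x t ≤ 33 * C * (|t| + |t| ^ 5) := by
  have hC := hg.nonneg
  refine csSup_le (Set.Nonempty.image _ ⟨0, by norm_num⟩) ?_
  rintro _ ⟨s, hs, rfl⟩
  have hs1 : |s| ≤ 1 := abs_le.mpr hs
  have h1 : |t + δ * s * t| ≤ 2 * |t| := by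
    calc |t + δ * s * t| ≤ |t| + |δ * s * t| := abs_add_le _ _
      _ = |t| + δ * |s| * |t| := by rw [abs_mul, abs_mul, abs_of_nonneg hδ]
      _ ≤ |t| + 1 * 1 * |t| := by gcongr
      _ = _ := by ring
  calc |g x (t + δ * s * t) - g x t| ≤ |g x (t + δ * s * t)| + |g x t| := abs_sub _ _
    _ ≤ C * (|t + δ * s * t| + |t + δ * s * t| ^ 5) + C * (|t| + |t| ^ 5) :=
        add_le_add (hg.bound _ _) (hg.bound _ _)
    _ ≤ C * (2 * |t| + (2 * |t|) ^ 5) + C * (|t| + |t| ^ 5) := by gcongr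
    -- `33 = 2⁵ + 1` comes from the fifth powers; the linear terms only need `3`.
    _ ≤ 33 * C * (|t| + |t| ^ 5) := by
        have : 0 ≤ C * |t| := by positivity
        nlinarith

/-- Writing the increment as `δst` makes the supremum run over a fixed compact interval. Joint
continuity then yields both measurability in `x` and decay as `δ → 0`. -/
lemma continuous_relOsc : Continuous fun q : ℝ × R3 × ℝ => relOsc g q.1 q.2.1 q.2.2 := by
  have hc : Continuous fun q : (ℝ × R3 × ℝ) × ℝ =>
      |g q.1.2.1 (q.1.2.2 + q.1.1 * q.2 * q.1.2.2) - g q.1.2.1 q.1.2.2| := by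
    have h1 : Continuous fun q : (ℝ × R3 × ℝ) × ℝ =>
        g q.1.2.1 (q.1.2.2 + q.1.1 * q.2 * q.1.2.2) :=
      hg.continuous.comp (f := fun q : (ℝ × R3 × ℝ) × ℝ =>
        (q.1.2.1, q.1.2.2 + q.1.1 * q.2 * q.1.2.2)) (by fun_prop)
    have h2 : Continuous fun q : (ℝ × R3 × ℝ) × ℝ => g q.1.2.1 q.1.2.2 :=
      hg.continuous.comp (f := fun q : (ℝ × R3 × ℝ) × ℝ => (q.1.2.1, q.1.2.2)) (by fun_prop)
    exact (h1.sub h2).abs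
  exact IsCompact.continuous_sSup (K := Set.Icc (-1 : ℝ) 1)
    (f := fun (q : ℝ × R3 × ℝ) (s : ℝ) => |g q.2.1 (q.2.2 + q.1 * s * q.2.2) - g q.2.1 q.2.2|)
    isCompact_Icc hc

lemma abs_sub_le_relOsc {δ : ℝ} (hδ : 0 < δ) (x : R3) {t r : ℝ} (hr : |r| ≤ δ * |t|) :
    |g x (t + r) - g x t| ≤ relOsc g δ x t := by
  have hcont : Continuous fun s : ℝ => |g x (t + δ * s * t) - g x t| :=
    (((hg.continuous_right x).comp (by fun_prop)).sub continuous_const).abs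
  have hbdd := (isCompact_Icc.image hcont (s := Set.Icc (-1 : ℝ) 1)).bddAbove
  rcases eq_or_ne t 0 with rfl | ht
  · have : r = 0 := by simpa using hr
    simp [this, relOsc_nonneg]
  · refine le_csSup hbdd ⟨r / (δ * t), ?_, ?_⟩
    · rw [Set.mem_Icc, ← abs_le, abs_div, abs_mul, abs_of_pos hδ]
      exact div_le_one_of_le₀ hr (by positivity)
    · have : δ * (r / (δ * t)) * t = r := by field_simp
      simp only [this]

lemma primitive_sub (x : R3) (t h : ℝ) :
    primitive g x (t + h) - primitive g x t = ∫ s in t..(t + h), g x s :=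
  intervalIntegral.integral_interval_sub_left ((hg.continuous_right x).intervalIntegrable _ _)
    ((hg.continuous_right x).intervalIntegrable _ _)

lemma remainder_le_of_small {δ : ℝ} (hδ : 0 < δ) (x : R3) {t h : ℝ} (hh : |h| ≤ δ * |t|) :
    |primitive g x (t + h) - primitive g x t - g x t * h| ≤ relOsc g δ x t * |h| := by
  have e : primitive g x (t + h) - primitive g x t - g x t * h
      = ∫ s in t..(t + h), (g x s - g x t) := by
    rw [intervalIntegral.integral_sub ((hg.continuous_right x).intervalIntegrable _ _)
      (continuous_const.intervalIntegrable _ _), hg.primitive_sub,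
      intervalIntegral.integral_const, smul_eq_mul]
    ring
  have hb : ∀ s ∈ Set.uIoc t (t + h), ‖g x s - g x t‖ ≤ relOsc g δ x t := fun s hs => by
    have hst : |s - t| ≤ |h| := by
      simpa using Set.abs_sub_left_of_mem_uIcc (Set.uIoc_subset_uIcc hs)
    have := hg.abs_sub_le_relOsc hδ x (hst.trans hh)
    rwa [add_sub_cancel] at this
  rw [e]
  simpa using intervalIntegral.norm_integral_le_of_norm_le_const hb

/-- No cancellation is used: `|t|` and `|t + h|` are both at most `(1 + 1/δ)|h|`, so each of the
three terms is bounded separately by powers of `h`. -/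
lemma remainder_le_of_large {δ : ℝ} (hδ : 0 < δ) (x : R3) {t h : ℝ} (hh : δ * |t| ≤ |h|) :
    |primitive g x (t + h) - primitive g x t - g x t * h|
      ≤ 3 * C * (1 + 1 / δ) ^ 6 * (h ^ 2 + h ^ 6) := by
  have hC := hg.nonneg
  set c := 1 + 1 / δ with hc
  have hd : 0 < 1 / δ := by positivity
  have hc1 : 1 ≤ c := by linarith
  have ht : |t| ≤ (c - 1) * |h| := by
    rw [hc, add_sub_cancel_left, one_div, inv_mul_eq_div, le_div_iff₀ hδ]; linarith
  have ht' : |t| ≤ c * |h| := ht.trans (by gcongr; linarith)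
  have hth : |t + h| ≤ c * |h| := (abs_add_le _ _).trans (by linarith)
  have hpow : ∀ y : ℝ, |y| ≤ c * |h| → y ^ 2 + y ^ 6 ≤ c ^ 6 * (h ^ 2 + h ^ 6) := fun y hy => by
    rw [← sq_abs y, ← sq_abs h, ← (show Even 6 by decide).pow_abs y,
      ← (show Even 6 by decide).pow_abs h]
    calc |y| ^ 2 + |y| ^ 6 ≤ (c * |h|) ^ 2 + (c * |h|) ^ 6 := by gcongr
      _ = c ^ 2 * |h| ^ 2 + c ^ 6 * |h| ^ 6 := by ring
      _ ≤ c ^ 6 * |h| ^ 2 + c ^ 6 * |h| ^ 6 := by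
          gcongr ?_ * _ + _
          exact pow_le_pow_right₀ hc1 (by norm_num)
      _ = _ := by ring
  have h1 := (hg.abs_primitive_le x (t + h)).trans
    (mul_le_mul_of_nonneg_left (hpow _ hth) hC)
  have h2 := (hg.abs_primitive_le x t).trans (mul_le_mul_of_nonneg_left (hpow _ ht') hC)
  have h3 : |g x t * h| ≤ C * (c ^ 6 * (h ^ 2 + h ^ 6)) := by
    rw [abs_mul, ← sq_abs h, ← (show Even 6 by decide).pow_abs h]
    calc |g x t| * |h| ≤ C * (|t| + |t| ^ 5) * |h| := by gcongr; exact hg.bound x t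
      _ ≤ C * (c * |h| + (c * |h|) ^ 5) * |h| := by gcongr
      _ = C * (c * |h| ^ 2 + c ^ 5 * |h| ^ 6) := by ring
      _ ≤ C * (c ^ 6 * |h| ^ 2 + c ^ 6 * |h| ^ 6) := by
          gcongr
          · exact le_self_pow₀ hc1 (by norm_num)
          · norm_num
      _ = _ := by ring
  calc |primitive g x (t + h) - primitive g x t - g x t * h|
      ≤ |primitive g x (t + h)| + |primitive g x t| + |g x t * h| :=
        (abs_sub _ _).trans (add_le_add_left (abs_sub _ _) _)
    _ ≤ _ := by linarith

/-- The parameter `l` will be the norm of the increment. After integration the first two terms are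
of order `l`, with factors made small by `τ` and then `δ`; the last is of order `l²` for `l ≤ 1`. -/
lemma remainder_le {δ τ l : ℝ} (hδ : 0 < δ) (hδ1 : δ ≤ 1) (hτ : 0 < τ) (hl : 0 < l)
    (x : R3) (t h : ℝ) :
    |primitive g x (t + h) - primitive g x t - g x t * h|
      ≤ l * τ * ((h / l) ^ 2 + (h / l) ^ 6)
        + l * (1 + 33 * C / τ) * (relOsc g δ x t * |t|)
        + 3 * C * (1 + 1 / δ) ^ 6 * (h ^ 2 + h ^ 6) := by
  have hC := hg.nonneg
  have hw := relOsc_nonneg g δ x t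
  have p1 : 0 ≤ l * τ * ((h / l) ^ 2 + (h / l) ^ 6) := by positivity
  have p2 : 0 ≤ l * (1 + 33 * C / τ) * (relOsc g δ x t * |t|) := by positivity
  have p3 : 0 ≤ 3 * C * (1 + 1 / δ) ^ 6 * (h ^ 2 + h ^ 6) := by positivity
  rcases le_total |h| (δ * |t|) with hh | hh
  · have h1 := hg.remainder_le_of_small hδ x hh
    have h2 := mul_le_of_le_add_pow_five (by positivity) hτ hw (abs_nonneg t)
      (show 0 ≤ |h| / l by positivity) (hg.relOsc_le hδ.le hδ1 x t)
    have h3 : relOsc g δ x t * |h| = l * (relOsc g δ x t * (|h| / l)) := by field_simp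
    have e2 : (|h| / l) ^ 2 = (h / l) ^ 2 := by rw [div_pow, div_pow, sq_abs]
    have e6 : (|h| / l) ^ 6 = (h / l) ^ 6 := by
      rw [div_pow, div_pow, (show Even 6 by decide).pow_abs]
    rw [e2, e6] at h2
    have h4 := mul_le_mul_of_nonneg_left h2 hl.le
    calc _ ≤ relOsc g δ x t * |h| := h1
      _ = l * (relOsc g δ x t * (|h| / l)) := h3
      _ ≤ _ := h4
      _ = l * τ * ((h / l) ^ 2 + (h / l) ^ 6)
        + l * (1 + 33 * C / τ) * (relOsc g δ x t * |t|) := by ring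
      _ ≤ _ := by linarith
  · have := hg.remainder_le_of_large hδ x hh
    linarith

lemma norm_relOsc_mul_le {δ : ℝ} (hδ : 0 ≤ δ) (hδ1 : δ ≤ 1) (x : R3) (t : ℝ) :
    ‖relOsc g δ x t * |t|‖ ≤ 33 * C * (t ^ 2 + t ^ 6) := by
  rw [norm_mul, Real.norm_of_nonneg (relOsc_nonneg _ _ _ _), Real.norm_of_nonneg (abs_nonneg _)]
  calc relOsc g δ x t * |t| ≤ 33 * C * (|t| + |t| ^ 5) * |t| := by
        gcongr; exact hg.relOsc_le hδ hδ1 x t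
    _ = 33 * C * (|t| ^ 2 + |t| ^ 6) := by ring
    _ = _ := by rw [sq_abs, (show Even 6 by decide).pow_abs]

section Integral

variable {u h : R3 → ℝ} (hu : AEStronglyMeasurable u volume)
  (hu2 : Integrable (fun x => u x ^ 2) volume) (hu6 : Integrable (fun x => u x ^ 6) volume)
include hu

lemma aestronglyMeasurable_primitive :
    AEStronglyMeasurable (fun x => primitive g x (u x)) volume :=
  hg.continuous_primitive.comp_aestronglyMeasurable
    (aestronglyMeasurable_id.prodMk hu)

lemma aestronglyMeasurable_comp : AEStronglyMeasurable (fun x => g x (u x)) volume :=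
  hg.continuous.comp_aestronglyMeasurable (aestronglyMeasurable_id.prodMk hu)

lemma aestronglyMeasurable_relOsc (δ : ℝ) :
    AEStronglyMeasurable (fun x => relOsc g δ x (u x)) volume :=
  hg.continuous_relOsc.comp_aestronglyMeasurable
    (aestronglyMeasurable_const.prodMk (aestronglyMeasurable_id.prodMk hu))

include hu2 hu6

lemma integrable_primitive : Integrable (fun x => primitive g x (u x)) volume :=
  ((hu2.add hu6).const_mul C).mono' (hg.aestronglyMeasurable_primitive hu)
    (Eventually.of_forall fun x => hg.abs_primitive_le x (u x))

lemma integrable_mul (hh : AEStronglyMeasurable h volume)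
    (hh2 : Integrable (fun x => h x ^ 2) volume) (hh6 : Integrable (fun x => h x ^ 6) volume) :
    Integrable (fun x => g x (u x) * h x) volume := by
  refine (((hu2.add hu6).add (hh2.add hh6)).const_mul C).mono'
    ((hg.aestronglyMeasurable_comp hu).mul hh) (Eventually.of_forall fun x => ?_)
  have hC := hg.nonneg
  have h1 := add_pow_five_mul_le (abs_nonneg (u x)) (abs_nonneg (h x))
  rw [sq_abs, sq_abs, (show Even 6 by decide).pow_abs, (show Even 6 by decide).pow_abs] at h1
  rw [norm_mul, Real.norm_eq_abs, Real.norm_eq_abs]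
  calc |g x (u x)| * |h x| ≤ C * (|u x| + |u x| ^ 5) * |h x| := by gcongr; exact hg.bound _ _
    _ = C * ((|u x| + |u x| ^ 5) * |h x|) := by ring
    _ ≤ _ := by simp only [Pi.add_apply]; gcongr

lemma integrable_relOsc_mul {δ : ℝ} (hδ : 0 ≤ δ) (hδ1 : δ ≤ 1) :
    Integrable (fun x => relOsc g δ x (u x) * |u x|) volume :=
  ((hu2.add hu6).const_mul (33 * C)).mono' ((hg.aestronglyMeasurable_relOsc hu δ).mul hu.norm)
    (Eventually.of_forall fun x => hg.norm_relOsc_mul_le hδ hδ1 x (u x))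

/-- Dominated convergence: the growth bound dominates for `δ ≤ 1`, and the integrand is continuous
in `δ` and vanishes at `δ = 0`. -/
lemma tendsto_integral_relOsc_mul :
    Tendsto (fun δ => ∫ x, relOsc g δ x (u x) * |u x|) (𝓝[>] 0) (𝓝 0) := by
  have h := tendsto_integral_filter_of_dominated_convergence (μ := (volume : Measure R3))
    (l := 𝓝[>] (0 : ℝ)) (F := fun δ x => relOsc g δ x (u x) * |u x|) (f := fun _ => 0)
    (fun x => 33 * C * (u x ^ 2 + u x ^ 6))
    (Eventually.of_forall fun δ => (hg.aestronglyMeasurable_relOsc hu δ).mul hu.norm)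
    (by
      filter_upwards [Ioc_mem_nhdsGT one_pos] with δ hδ
      exact Eventually.of_forall fun x => hg.norm_relOsc_mul_le hδ.1.le hδ.2 x (u x))
    ((hu2.add hu6).const_mul (33 * C))
    (Eventually.of_forall fun x => by
      have h1 : Tendsto (fun δ => relOsc g δ x (u x) * |u x|) (𝓝 0)
          (𝓝 (relOsc g 0 x (u x) * |u x|)) :=
        ((hg.continuous_relOsc.comp (f := fun δ : ℝ => (δ, x, u x))
          (by fun_prop)).mul continuous_const).tendsto 0
      rw [relOsc_zero, zero_mul] at h1
      exact h1.mono_left nhdsWithin_le_nhds)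
  simpa using h

/-- First-order expansion of `∫ G(x, u)`, uniformly over increments controlled in `L²` and
`L⁶`. -/
lemma exists_integral_remainder_le {K : ℝ} (hK : 0 ≤ K) {ε : ℝ} (hε : 0 < ε) :
    ∃ r > 0, ∀ (h : R3 → ℝ) (l : ℝ), 0 < l → l < r → AEStronglyMeasurable h volume →
      Integrable (fun x => h x ^ 2) volume → Integrable (fun x => h x ^ 6) volume →
      ∫ x, h x ^ 2 ≤ K * l ^ 2 → ∫ x, h x ^ 6 ≤ K * l ^ 6 →
      ∫ x, |primitive g x (u x + h x) - primitive g x (u x) - g x (u x) * h x| ≤ ε * l := by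
  have hC := hg.nonneg
  -- Order of choice: `τ` from `K` and `ε`, then `δ` depending on `τ`, then the radius depending on
  -- `δ`. Each of the three remainder terms receives `εl/3`.
  set τ := ε / (6 * (K + 1)) with hτdef
  have hτ : 0 < τ := by positivity
  have hτK : τ * (K + K) ≤ ε / 3 := by
    rw [hτdef, div_mul_eq_mul_div, div_le_div_iff₀ (by positivity) (by norm_num)]
    nlinarith
  set c := 1 + 33 * C / τ with hcdef
  have hc : 0 < c := by positivity
  obtain ⟨δ, ⟨hδ, hδ1⟩, hδs⟩ : ∃ δ : ℝ, δ ∈ Set.Ioc (0 : ℝ) 1 ∧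
      ∫ x, relOsc g δ x (u x) * |u x| < ε / (3 * c) :=
    ((Filter.Eventually.and (Ioc_mem_nhdsGT one_pos)
      ((hg.tendsto_integral_relOsc_mul hu hu2 hu6).eventually
        (gt_mem_nhds (show 0 < ε / (3 * c) by positivity))))).exists
  set D := 3 * C * (1 + 1 / δ) ^ 6 with hD
  have hD0 : 0 ≤ D := by positivity
  refine ⟨min 1 (ε / (6 * (D * K + 1))), by positivity, fun h l hl hlr hh hh2 hh6 hb2 hb6 => ?_⟩
  have hl1 : l ≤ 1 := (hlr.trans_le (min_le_left _ _)).le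
  have hlD : l ≤ ε / (6 * (D * K + 1)) := (hlr.trans_le (min_le_right _ _)).le
  have i1 : Integrable (fun x => l * τ * ((h x / l) ^ 2 + (h x / l) ^ 6)) volume := by
    simp only [div_pow]
    exact ((hh2.div_const _).add (hh6.div_const _)).const_mul _
  have i2 := (hg.integrable_relOsc_mul hu hu2 hu6 hδ.le hδ1).const_mul (l * c)
  have i3 : Integrable (fun x => D * (h x ^ 2 + h x ^ 6)) volume := (hh2.add hh6).const_mul D
  have i12 : Integrable (fun x => l * τ * ((h x / l) ^ 2 + (h x / l) ^ 6)
      + l * c * (relOsc g δ x (u x) * |u x|)) volume := i1.add i2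
  have hle : ∫ x, |primitive g x (u x + h x) - primitive g x (u x) - g x (u x) * h x|
      ≤ ∫ x, (l * τ * ((h x / l) ^ 2 + (h x / l) ^ 6)
        + l * c * (relOsc g δ x (u x) * |u x|) + D * (h x ^ 2 + h x ^ 6)) :=
    integral_mono_of_nonneg (Eventually.of_forall fun x => abs_nonneg _) (i12.add i3)
      (Eventually.of_forall fun x => hg.remainder_le hδ hδ1 hτ hl x (u x) (h x))
  have e : ∫ x, (l * τ * ((h x / l) ^ 2 + (h x / l) ^ 6)
        + l * c * (relOsc g δ x (u x) * |u x|) + D * (h x ^ 2 + h x ^ 6))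
      = l * τ * ((∫ x, h x ^ 2) / l ^ 2 + (∫ x, h x ^ 6) / l ^ 6)
        + l * c * (∫ x, relOsc g δ x (u x) * |u x|)
        + D * ((∫ x, h x ^ 2) + ∫ x, h x ^ 6) := by
    rw [integral_add i12 i3, integral_add i1 i2, integral_const_mul, integral_const_mul,
      integral_const_mul, integral_add hh2 hh6]
    simp only [div_pow]
    rw [integral_add (hh2.div_const _) (hh6.div_const _), integral_div, integral_div]
  have q2 : (∫ x, h x ^ 2) / l ^ 2 ≤ K := by rwa [div_le_iff₀ (by positivity)]
  have q6 : (∫ x, h x ^ 6) / l ^ 6 ≤ K := by rwa [div_le_iff₀ (by positivity)]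
  have b1 : l * τ * ((∫ x, h x ^ 2) / l ^ 2 + (∫ x, h x ^ 6) / l ^ 6) ≤ l * (ε / 3) := by
    calc _ ≤ l * τ * (K + K) := by gcongr
      _ = l * (τ * (K + K)) := by ring
      _ ≤ _ := by gcongr
  have b2 : l * c * (∫ x, relOsc g δ x (u x) * |u x|) ≤ l * (ε / 3) := by
    calc _ ≤ l * c * (ε / (3 * c)) := by gcongr
      _ = _ := by field_simp
  have b3 : D * ((∫ x, h x ^ 2) + ∫ x, h x ^ 6) ≤ l * (ε / 3) := by
    have hl6 : l ^ 6 ≤ l ^ 2 := pow_le_pow_of_le_one hl.le hl1 (by norm_num)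
    calc D * ((∫ x, h x ^ 2) + ∫ x, h x ^ 6) ≤ D * (K * l ^ 2 + K * l ^ 6) := by gcongr
      _ ≤ D * (K * l ^ 2 + K * l ^ 2) := by gcongr
      _ = l * (2 * (D * K) * l) := by ring
      _ ≤ l * (2 * (D * K) * (ε / (6 * (D * K + 1)))) := by gcongr
      _ ≤ l * (ε / 3) := by
          gcongr
          rw [mul_div_assoc', div_le_div_iff₀ (by positivity) (by norm_num)]
          nlinarith
  calc _ ≤ _ := hle
    _ = _ := e
    _ ≤ ε * l := by linarith

end Integral

end IsSobolevGrowth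

/-! ### Fréchet derivative of the integral functional on the energy space -/

namespace EnergySpace

variable {a : ℝ} {ha : 0 < a} {V : C(R3, ℝ)}

/-- The joint embedding of the energy space into `L² ∩ L⁶`. -/
lemma exists_embedding (a : ℝ) (ha : 0 < a) (V : C(R3, ℝ)) {M : ℝ} (hM : 0 < M)
    (hS : volume {x | Vplus V x < M} < ⊤) : ∃ K : ℝ, 0 ≤ K ∧ ∀ u : EnergySpace a ha V,
      Integrable (fun x => u.toFun x ^ 6) volume ∧
      ∫ x, u.toFun x ^ 2 ≤ K * ‖u‖ ^ 2 ∧ ∫ x, u.toFun x ^ 6 ≤ K * ‖u‖ ^ 6 := by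
  obtain ⟨K, hK0, hK⟩ := exists_integral_pow_six_le a ha V
  obtain ⟨K', hK0', hK'⟩ := exists_integral_sq_le a ha V hM hS
  refine ⟨max K' K, hK0.trans (le_max_right _ _), fun u => ⟨(hK u).1, (hK' u).trans ?_,
    (hK u).2.trans ?_⟩⟩
  · gcongr; exact le_max_left _ _
  · gcongr; exact le_max_right _ _

lemma toFun_add_ae (u v : EnergySpace a ha V) :
    (u + v).toFun =ᵐ[volume] fun x => u.toFun x + v.toFun x := by
  rw [toFun_add]; exact Lp.coeFn_add _ _

lemma toFun_smul_ae (c : ℝ) (u : EnergySpace a ha V) :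
    (c • u).toFun =ᵐ[volume] fun x => c * u.toFun x := by
  rw [toFun_smul]; exact Lp.coeFn_smul _ _

lemma aestronglyMeasurable (u : EnergySpace a ha V) : AEStronglyMeasurable u.toFun volume :=
  Lp.aestronglyMeasurable _

/-- The linear functional `h ↦ ∫ g(x, u) h`. -/
lemma exists_pairing {g : R3 → ℝ → ℝ} {C : ℝ} (hg : IsSobolevGrowth g C) {K : ℝ}
    (hK : ∀ u : EnergySpace a ha V, Integrable (fun x => u.toFun x ^ 6) volume ∧
      ∫ x, u.toFun x ^ 2 ≤ K * ‖u‖ ^ 2 ∧ ∫ x, u.toFun x ^ 6 ≤ K * ‖u‖ ^ 6)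
    (u : EnergySpace a ha V) :
    ∃ D : EnergySpace a ha V →L[ℝ] ℝ, ∀ h, D h = ∫ x, g x (u.toFun x) * h.toFun x := by
  have hC := hg.nonneg
  have hint : ∀ h : EnergySpace a ha V,
      Integrable (fun x => g x (u.toFun x) * h.toFun x) volume := fun h =>
    hg.integrable_mul u.aestronglyMeasurable u.integrable_sq (hK u).1 h.aestronglyMeasurable
      h.integrable_sq (hK h).1
  let L : EnergySpace a ha V →ₗ[ℝ] ℝ :=
    { toFun := fun h => ∫ x, g x (u.toFun x) * h.toFun x
      map_add' := fun h k => by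
        rw [← integral_add (hint h) (hint k)]
        refine integral_congr_ae ?_
        filter_upwards [toFun_add_ae h k] with x hx
        rw [hx, mul_add]
      map_smul' := fun c h => by
        rw [RingHom.id_apply, smul_eq_mul, ← integral_const_mul]
        refine integral_congr_ae ?_
        filter_upwards [toFun_smul_ae c h] with x hx
        rw [hx]; ring }
  set I := (∫ x, u.toFun x ^ 2) + ∫ x, u.toFun x ^ 6 with hI
  refine ⟨L.mkContinuous (C * (I + (K + K))) fun h => ?_, fun h => rfl⟩
  rcases eq_or_ne h 0 with rfl | hne
  · simp
  have hl : 0 < ‖h‖ := norm_pos_iff.mpr hne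
  have i1 : Integrable (fun x => u.toFun x ^ 2 + u.toFun x ^ 6) volume :=
    u.integrable_sq.add (hK u).1
  have i2 : Integrable (fun x => (h.toFun x / ‖h‖) ^ 2 + (h.toFun x / ‖h‖) ^ 6) volume := by
    simp only [div_pow]
    exact (h.integrable_sq.div_const _).add ((hK h).1.div_const _)
  -- Normalising `h` by `‖h‖` before the pointwise inequality turns its inhomogeneous bound into one
  -- linear in `‖h‖`.
  have hpt : ∀ x, ‖g x (u.toFun x) * h.toFun x‖ ≤ ‖h‖ * C * ((u.toFun x ^ 2 + u.toFun x ^ 6)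
      + ((h.toFun x / ‖h‖) ^ 2 + (h.toFun x / ‖h‖) ^ 6)) := fun x => by
    have h1 := add_pow_five_mul_le (abs_nonneg (u.toFun x)) (abs_nonneg (h.toFun x / ‖h‖))
    simp only [sq_abs, (show Even 6 by decide).pow_abs] at h1
    rw [norm_mul, Real.norm_eq_abs, Real.norm_eq_abs]
    calc |g x (u.toFun x)| * |h.toFun x|
        ≤ C * (|u.toFun x| + |u.toFun x| ^ 5) * |h.toFun x| := by gcongr; exact hg.bound _ _
      _ = ‖h‖ * C * ((|u.toFun x| + |u.toFun x| ^ 5) * |h.toFun x / ‖h‖|) := by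
          rw [abs_div, abs_of_pos hl]; field_simp
      _ ≤ _ := by gcongr
  have hle := norm_integral_le_of_norm_le ((i1.add i2).const_mul (‖h‖ * C))
    (Eventually.of_forall hpt)
  have q2 : (∫ x, h.toFun x ^ 2) / ‖h‖ ^ 2 ≤ K := by
    rw [div_le_iff₀ (by positivity)]; exact (hK h).2.1
  have q6 : (∫ x, h.toFun x ^ 6) / ‖h‖ ^ 6 ≤ K := by
    rw [div_le_iff₀ (by positivity)]; exact (hK h).2.2
  refine hle.trans ?_
  simp only [Pi.add_apply]
  rw [integral_const_mul, integral_add i1 i2, integral_add u.integrable_sq (hK u).1]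
  simp only [div_pow]
  rw [integral_add (h.integrable_sq.div_const _) ((hK h).1.div_const _), integral_div,
    integral_div]
  calc _ ≤ ‖h‖ * C * (I + (K + K)) := by gcongr
    _ = _ := by ring

/-- Fréchet differentiability of `u ↦ ∫ G(x, u)` on the energy space. -/
theorem hasFDerivAt_integral_primitive {g : R3 → ℝ → ℝ} {C : ℝ} (hg : IsSobolevGrowth g C)
    {K : ℝ} (hK0 : 0 ≤ K)
    (hK : ∀ u : EnergySpace a ha V, Integrable (fun x => u.toFun x ^ 6) volume ∧
      ∫ x, u.toFun x ^ 2 ≤ K * ‖u‖ ^ 2 ∧ ∫ x, u.toFun x ^ 6 ≤ K * ‖u‖ ^ 6)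
    (u : EnergySpace a ha V) {D : EnergySpace a ha V →L[ℝ] ℝ}
    (hD : ∀ h, D h = ∫ x, g x (u.toFun x) * h.toFun x) :
    HasFDerivAt (fun w : EnergySpace a ha V => ∫ x, primitive g x (w.toFun x)) D u := by
  rw [hasFDerivAt_iff_isLittleO_nhds_zero, Asymptotics.isLittleO_iff]
  intro ε hε
  obtain ⟨r, hr, H⟩ := hg.exists_integral_remainder_le u.aestronglyMeasurable u.integrable_sq
    (hK u).1 hK0 hε
  filter_upwards [Metric.ball_mem_nhds (0 : EnergySpace a ha V) hr] with h hh
  rcases eq_or_ne h 0 with rfl | hne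
  · simp
  rw [mem_ball_zero_iff] at hh
  have hP : ∀ w : EnergySpace a ha V, Integrable (fun x => primitive g x (w.toFun x)) volume :=
    fun w => hg.integrable_primitive w.aestronglyMeasurable w.integrable_sq (hK w).1
  have hPa : Integrable (fun x => primitive g x (u.toFun x + h.toFun x)) volume := by
    refine (hP (u + h)).congr ?_
    filter_upwards [toFun_add_ae u h] with x hx
    rw [hx]
  have hPd : Integrable (fun x => primitive g x (u.toFun x + h.toFun x)
      - primitive g x (u.toFun x)) volume := hPa.sub (hP u)
  have hm := hg.integrable_mul u.aestronglyMeasurable u.integrable_sq (hK u).1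
    h.aestronglyMeasurable h.integrable_sq (hK h).1
  have e : (∫ x, primitive g x ((u + h).toFun x)) - (∫ x, primitive g x (u.toFun x)) - D h
      = ∫ x, (primitive g x (u.toFun x + h.toFun x) - primitive g x (u.toFun x)
        - g x (u.toFun x) * h.toFun x) := by
    rw [integral_sub hPd hm, integral_sub hPa (hP u), hD]
    congr 2
    refine integral_congr_ae ?_
    filter_upwards [toFun_add_ae u h] with x hx
    rw [hx]
  rw [e]
  exact (norm_integral_le_integral_norm _).trans (H h.toFun ‖h‖ (norm_pos_iff.mpr hne) hh
    h.aestronglyMeasurable h.integrable_sq (hK h).1 (hK h).2.1 (hK h).2.2)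

/-- The weak gradient as a bounded operator on the energy space. -/
def gradL (a : ℝ) (ha : 0 < a) (V : C(R3, ℝ)) :
    EnergySpace a ha V →L[ℝ] Lp R3 2 (volume : Measure R3) :=
  LinearMap.mkContinuous
    { toFun := fun u => u.grad, map_add' := grad_add, map_smul' := grad_smul } (1 / √a) fun u => by
    refine le_of_sq_le_sq ?_ (by positivity)
    rw [mul_pow, div_pow, Real.sq_sqrt ha.le, one_pow, one_div_mul_eq_div]
    exact u.norm_grad_sq_le

lemma gradL_apply (u : EnergySpace a ha V) : gradL a ha V u = u.grad := rfl

end EnergySpace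

/-! ### The energy and its derivative, with `V⁻` absorbed into the nonlinearity -/

/-- The negative part of the potential. -/
def Vminus (V : C(R3, ℝ)) (x : R3) : ℝ := max (-V x) 0

lemma Vminus_nonneg (V : C(R3, ℝ)) (x : R3) : 0 ≤ Vminus V x := le_max_right _ _

lemma continuous_Vminus (V : C(R3, ℝ)) : Continuous (Vminus V) :=
  V.continuous.neg.max continuous_const

lemma Vplus_sub_Vminus (V : C(R3, ℝ)) (x : R3) : Vplus V x - Vminus V x = V x := by
  unfold Vplus Vminus
  rcases le_total (V x) 0 with h | h
  · rw [max_eq_right h, max_eq_left (by linarith)]; ring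
  · rw [max_eq_left h, max_eq_right (by linarith)]; ring

lemma Vminus_eq_zero_of_Vplus_pos {V : C(R3, ℝ)} {x : R3} (h : 0 < Vplus V x) :
    Vminus V x = 0 := by
  unfold Vplus at h
  have : 0 < V x := by simpa using h
  exact max_eq_right (by linarith)

lemma Vminus_le {V : C(R3, ℝ)} {m : ℝ} (hm : ∀ x, m ≤ V x) (x : R3) : Vminus V x ≤ |m| :=
  max_le ((neg_le_neg (hm x)).trans (neg_le_abs m)) (abs_nonneg m)

/-- The nonlinearity that absorbs the negative part of the potential. -/
def shifted (V : C(R3, ℝ)) (f : R3 → ℝ → ℝ) (x : R3) (t : ℝ) : ℝ := f x t + Vminus V x * t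

lemma primitive_shifted {V : C(R3, ℝ)} {f : R3 → ℝ → ℝ} (hf : Continuous (Function.uncurry f))
    (x : R3) (t : ℝ) :
    primitive (shifted V f) x t = primitive f x t + 1 / 2 * (Vminus V x * t ^ 2) := by
  unfold primitive shifted
  have h1 : Continuous (f x) := hf.comp (Continuous.prodMk_right x)
  have h2 : Continuous fun s => Vminus V x * s := continuous_const.mul continuous_id
  rw [intervalIntegral.integral_add (h1.intervalIntegrable _ _) (h2.intervalIntegrable _ _),
    intervalIntegral.integral_const_mul, integral_id]
  ring

lemma IsSobolevGrowth.shifted {V : C(R3, ℝ)} {m : ℝ} (hm : ∀ x, m ≤ V x) {f : R3 → ℝ → ℝ}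
    {C : ℝ} (hf : IsSobolevGrowth f C) : IsSobolevGrowth (shifted V f) (C + |m|) where
  continuous := hf.continuous.add (((continuous_Vminus V).comp continuous_fst).mul continuous_snd)
  nonneg := add_nonneg hf.nonneg (abs_nonneg m)
  bound x t := by
    have h1 : |Vminus V x * t| ≤ |m| * (|t| + |t| ^ 5) := by
      rw [abs_mul, abs_of_nonneg (Vminus_nonneg V x)]
      exact mul_le_mul (Vminus_le hm x) (le_add_of_nonneg_right (by positivity)) (abs_nonneg _)
        (abs_nonneg _)
    calc |f x t + Vminus V x * t| ≤ |f x t| + |Vminus V x * t| := abs_add_le _ _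
      _ ≤ C * (|t| + |t| ^ 5) + |m| * (|t| + |t| ^ 5) := add_le_add (hf.bound x t) h1
      _ = _ := by ring

/-- Subcritical growth together with `f(x, t) = o(t)` at `t = 0`. -/
lemma exists_isSobolevGrowth {f : R3 → ℝ → ℝ} (hf : Continuous (Function.uncurry f)) {p : ℝ}
    (hp : 1 ≤ p) (hp6 : p ≤ 6) {C : ℝ} (hC : 0 ≤ C)
    (hgrowth : ∀ x t, |f x t| ≤ C * (1 + |t| ^ (p - 1))) {δ : ℝ} (hδ : 0 < δ)
    (hzero : ∀ x t, |t| < δ → |f x t| ≤ 1 * |t|) : ∃ C', IsSobolevGrowth f C' := by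
  -- The summand `1` serves `|t| < δ`. For `|t| ≥ δ`, `1 + |t|^(p-1) ≤ 2 + |t|⁵`, and the constant
  -- is absorbed by `2 ≤ (2/δ)|t|`.
  refine ⟨1 + C * (1 + 2 / δ), hf, by positivity, fun x t => ?_⟩
  rcases lt_or_ge |t| δ with h | h
  · refine (hzero x t h).trans ?_
    have h1 : 0 ≤ C * (1 + 2 / δ) := by positivity
    have h2 : 0 ≤ |t| ^ 5 := by positivity
    have h3 := abs_nonneg t
    nlinarith [mul_nonneg h1 (add_nonneg h3 h2)]
  · have h1 : |t| ^ (p - 1) ≤ 1 + |t| ^ 5 := by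
      rcases le_total |t| 1 with h1 | h1
      · have := Real.rpow_le_one (abs_nonneg t) h1 (show 0 ≤ p - 1 by linarith)
        have h2 : 0 ≤ |t| ^ 5 := by positivity
        linarith
      · have := Real.rpow_le_rpow_of_exponent_le h1 (show p - 1 ≤ (5 : ℕ) by push_cast; linarith)
        rw [Real.rpow_natCast] at this
        linarith
    have h2 : 2 ≤ 2 / δ * |t| := by
      rw [div_mul_eq_mul_div, le_div_iff₀ hδ]; linarith
    have h3 : 1 + |t| ^ (p - 1) ≤ (1 + 2 / δ) * (|t| + |t| ^ 5) := by
      have h4 : 0 ≤ 2 / δ * |t| ^ 5 := by positivity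
      have := abs_nonneg t
      linarith [show (1 + 2 / δ) * (|t| + |t| ^ 5)
        = |t| + |t| ^ 5 + 2 / δ * |t| + 2 / δ * |t| ^ 5 by ring]
    calc |f x t| ≤ C * (1 + |t| ^ (p - 1)) := hgrowth x t
      _ ≤ C * ((1 + 2 / δ) * (|t| + |t| ^ 5)) := by gcongr
      _ ≤ (1 + C * (1 + 2 / δ)) * (|t| + |t| ^ 5) := by
          have : 0 ≤ |t| + |t| ^ 5 := by positivity
          linarith [show (1 + C * (1 + 2 / δ)) * (|t| + |t| ^ 5)
            = |t| + |t| ^ 5 + C * ((1 + 2 / δ) * (|t| + |t| ^ 5)) by ring]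

section Energy

variable {a : ℝ} {ha : 0 < a} {V : C(R3, ℝ)} {m : ℝ} (hm : ∀ x, m ≤ V x)
  {f : R3 → ℝ → ℝ} {C : ℝ} (hf : IsSobolevGrowth f C) {K : ℝ} (hK0 : 0 ≤ K)
  (hK : ∀ u : EnergySpace a ha V, Integrable (fun x => u.toFun x ^ 6) volume ∧
    ∫ x, u.toFun x ^ 2 ≤ K * ‖u‖ ^ 2 ∧ ∫ x, u.toFun x ^ 6 ≤ K * ‖u‖ ^ 6)
include hm

lemma integrable_Vminus_sq (u : EnergySpace a ha V) :
    Integrable (fun x => Vminus V x * u.toFun x ^ 2) volume :=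
  (u.integrable_sq.const_mul |m|).mono'
    ((continuous_Vminus V).aestronglyMeasurable.mul (u.aestronglyMeasurable.pow 2))
    (Eventually.of_forall fun x => by
      rw [Real.norm_of_nonneg (mul_nonneg (Vminus_nonneg V x) (sq_nonneg _))]
      exact mul_le_mul_of_nonneg_right (Vminus_le hm x) (sq_nonneg _))

include hf hK

/-- With `V⁻` moved into the nonlinearity, the quadratic part is exactly `½‖u‖²`. What remains is a
power of the norm of a bounded operator and an integral functional already known to be
differentiable. -/
lemma energy_eq (b : ℝ) (u : EnergySpace a ha V) :
    energy a ha b V f u = 1 / 2 * ‖u‖ ^ 2 + b / 4 * (‖EnergySpace.gradL a ha V u‖ ^ 2) ^ 2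
      - ∫ x, primitive (shifted V f) x (u.toFun x) := by
  have i1 : Integrable (fun x => a * ‖u.grad x‖ ^ 2 + Vplus V x * u.toFun x ^ 2) volume :=
    (u.integrable_norm_grad_sq.const_mul a).add u.integrable_Vplus_sq
  have i2 := integrable_Vminus_sq hm u
  have e1 : ∫ x, (a * ‖u.grad x‖ ^ 2 + V x * u.toFun x ^ 2)
      = ‖u‖ ^ 2 - ∫ x, Vminus V x * u.toFun x ^ 2 := by
    rw [EnergySpace.norm_sq_eq, ← integral_sub i1 i2]
    refine integral_congr_ae (Eventually.of_forall fun x => ?_)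
    simp only [← Vplus_sub_Vminus V x]
    ring
  have e2 : ∫ x, primitive (shifted V f) x (u.toFun x)
      = (∫ x, primitive f x (u.toFun x)) + 1 / 2 * ∫ x, Vminus V x * u.toFun x ^ 2 := by
    rw [← integral_const_mul, ← integral_add (hf.integrable_primitive u.aestronglyMeasurable
      u.integrable_sq (hK u).1) (i2.const_mul _)]
    exact integral_congr_ae (Eventually.of_forall fun x => primitive_shifted hf.continuous x _)
  rw [energy, e1, e2, EnergySpace.integral_norm_grad_sq, EnergySpace.gradL_apply]
  ring

/-- The coefficient `b/(4a²)`, from `‖∇u‖² ≤ ‖u‖²/a`, is the one that `∫ F(x, u)` has to beat. -/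
lemma energy_le {b : ℝ} (hb : 0 ≤ b) (u : EnergySpace a ha V) :
    energy a ha b V f u ≤ 1 / 2 * ‖u‖ ^ 2 + b / (4 * a ^ 2) * ‖u‖ ^ 4
      - ∫ x, primitive f x (u.toFun x) := by
  have hg := hf.shifted hm
  have h1 : ∫ x, primitive f x (u.toFun x) ≤ ∫ x, primitive (shifted V f) x (u.toFun x) := by
    refine integral_mono
      (hf.integrable_primitive u.aestronglyMeasurable u.integrable_sq (hK u).1)
      (hg.integrable_primitive u.aestronglyMeasurable u.integrable_sq (hK u).1) fun x => ?_
    simp only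
    rw [primitive_shifted hf.continuous]
    have := mul_nonneg (Vminus_nonneg V x) (sq_nonneg (u.toFun x))
    linarith
  have h2 : b / 4 * (‖u.grad‖ ^ 2) ^ 2 ≤ b / (4 * a ^ 2) * ‖u‖ ^ 4 := by
    calc b / 4 * (‖u.grad‖ ^ 2) ^ 2 ≤ b / 4 * (‖u‖ ^ 2 / a) ^ 2 := by
          gcongr; exact u.norm_grad_sq_le
      _ = _ := by field_simp
  rw [energy_eq hm hf hK, EnergySpace.gradL_apply]
  linarith

include hK0

/-- The derivative of the energy along `u` at `u`. -/
theorem fderiv_energy_self (b : ℝ) (u : EnergySpace a ha V) :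
    fderiv ℝ (energy a ha b V f) u u = ‖u‖ ^ 2 + b * (‖u.grad‖ ^ 2) ^ 2
      - ∫ x, shifted V f x (u.toFun x) * u.toFun x := by
  have hg := hf.shifted hm
  obtain ⟨D, hD⟩ := EnergySpace.exists_pairing hg hK u
  have h1 := EnergySpace.hasFDerivAt_integral_primitive hg hK0 hK u hD
  have h2 := ((hasFDerivAt_id u).norm_sq).const_mul (1 / 2)
  have h3 := (((EnergySpace.gradL a ha V).hasFDerivAt (x := u)).norm_sq.pow 2).const_mul (b / 4)
  -- Differentiability is essential here, since `fderiv` is zero by default where it fails.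
  have h4 : HasFDerivAt (energy a ha b V f) _ u :=
    ((h2.add h3).sub h1).congr_of_eventuallyEq
      (Eventually.of_forall fun w => energy_eq hm hf hK b w)
  rw [h4.fderiv]
  simp [hD, EnergySpace.gradL_apply]
  ring

/-- The Nehari-type combination `Φ - ¼ Φ'(u)u` controls the quadratic part. -/
lemma sub_quarter_fderiv_energy_ge (hAR : ∀ x t, 4 * primitive f x t ≤ t * f x t) (b : ℝ)
    (u : EnergySpace a ha V) :
    ‖u‖ ^ 2 - ∫ x, Vminus V x * u.toFun x ^ 2
      ≤ 4 * energy a ha b V f u - fderiv ℝ (energy a ha b V f) u u := by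
  have hg := hf.shifted hm
  have i1 := hg.integrable_primitive u.aestronglyMeasurable u.integrable_sq (hK u).1
  have i2 := hg.integrable_mul u.aestronglyMeasurable u.integrable_sq (hK u).1
    u.aestronglyMeasurable u.integrable_sq (hK u).1
  have i3 := integrable_Vminus_sq hm u
  -- Since `V⁻t` has primitive `½V⁻t²`, four times the primitive minus the pairing leaves one copy
  -- of `V⁻t²`.
  have hle : 4 * ∫ x, primitive (shifted V f) x (u.toFun x)
      ≤ (∫ x, shifted V f x (u.toFun x) * u.toFun x) + ∫ x, Vminus V x * u.toFun x ^ 2 := by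
    rw [← integral_const_mul, ← integral_add i2 i3]
    refine integral_mono (i1.const_mul 4) (i2.add i3) fun x => ?_
    simp only
    rw [primitive_shifted hf.continuous, shifted]
    linarith [hAR x (u.toFun x)]
  -- The factor `4` cancels the Kirchhoff terms, `4·b/4 - b = 0`, and leaves `2‖u‖² - ‖u‖²`.
  rw [energy_eq hm hf hK, fderiv_energy_self hm hf hK0 hK, EnergySpace.gradL_apply]
  linarith

end Energy

/-! ### Non-vanishing on a set of finite measure and superquartic growth -/

/-- Quantitative non-vanishing: a function with a definite `L²` mass on a set of finite measure
and bounded `L⁶` norm is bounded below on a set of definite measure. -/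
lemma exists_measure_superlevel_ge {S : Set R3} (hSm : MeasurableSet S) (hS : volume S < ⊤)
    {K d : ℝ} (hK : 0 ≤ K) (hd : 0 < d) : ∃ η κ : ℝ, 0 < η ∧ 0 < κ ∧ ∀ (u : R3 → ℝ) (l : ℝ),
      0 < l → AEStronglyMeasurable u volume → Integrable (fun x => u x ^ 2) volume →
      Integrable (fun x => u x ^ 6) volume → ∫ x, u x ^ 6 ≤ K * l ^ 6 →
      d * l ^ 2 ≤ ∫ x, S.indicator (fun x => u x ^ 2) x →
      κ ≤ volume.real {x ∈ S | η * l ≤ |u x|} := by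
  set s := volume.real S with hs
  have hs0 : 0 ≤ s := measureReal_nonneg
  -- Values of `|u|` below `ηl` contribute at most `dl²/4` on `S`; the `+ 1` covers a null set `S`.
  set η := √(d / (4 * (s + 1))) with hη
  have hη0 : 0 < η := Real.sqrt_pos.mpr (by positivity)
  have hη2 : η ^ 2 * s ≤ d / 4 := by
    rw [hη, Real.sq_sqrt (by positivity), div_mul_eq_mul_div,
      div_le_div_iff₀ (by positivity) (by norm_num)]
    nlinarith
  -- Values above `Ll` contribute at most `(K/L⁴)l² ≤ dl²/4`, by the `L⁶` bound. The other half of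
  -- the mass sits where `ηl ≤ |u| ≤ Ll`, which gives `κ = d/(2L²)`.
  set L := 1 + 4 * K / d with hL
  have hL1 : 1 ≤ L := by
    have : 0 ≤ 4 * K / d := by positivity
    linarith
  have hL4 : K / L ^ 4 ≤ d / 4 := by
    rw [div_le_div_iff₀ (by positivity) (by norm_num)]
    have h1 : d * L = d + 4 * K := by rw [hL]; field_simp
    have h2 : L ≤ L ^ 4 := le_self_pow₀ hL1 (by norm_num)
    nlinarith
  refine ⟨η, d / (2 * L ^ 2), hη0, by positivity, fun u l hl hu hu2 hu6 hb6 hmass => ?_⟩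
  set A : Set R3 := {x ∈ S | η * l ≤ |u x|} with hA
  have hAn : NullMeasurableSet A volume :=
    hSm.nullMeasurableSet.inter (nullMeasurableSet_le aemeasurable_const
      hu.aemeasurable.abs)
  have hAfin : volume A < ⊤ := (measure_mono fun x hx => hx.1).trans_lt hS
  have iS : Integrable (S.indicator fun _ => (1 : ℝ)) volume :=
    (integrable_indicator_iff hSm).mpr (integrableOn_const hS.ne)
  have iA : Integrable (A.indicator fun _ => (1 : ℝ)) volume :=
    (integrableOn_const hAfin.ne).integrable_indicator₀ hAn
  have eS : ∫ x, S.indicator (fun _ => (1 : ℝ)) x = s := by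
    rw [integral_indicator hSm]; simp [hs]
  have eA : ∫ x, A.indicator (fun _ => (1 : ℝ)) x = volume.real A := by
    rw [integral_indicator₀ hAn]; simp
  have hpt : ∀ x, S.indicator (fun x => u x ^ 2) x
      ≤ (η * l) ^ 2 * S.indicator (fun _ => (1 : ℝ)) x + 1 / (L * l) ^ 4 * u x ^ 6
        + (L * l) ^ 2 * A.indicator (fun _ => (1 : ℝ)) x := fun x => by
    have n6 : 0 ≤ 1 / (L * l) ^ 4 * u x ^ 6 := by positivity
    have nA : 0 ≤ (L * l) ^ 2 * A.indicator (fun _ => (1 : ℝ)) x :=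
      mul_nonneg (by positivity) (Set.indicator_nonneg (fun _ _ => zero_le_one) x)
    have nη : 0 ≤ (η * l) ^ 2 := by positivity
    by_cases hx : x ∈ S
    · rw [Set.indicator_of_mem hx, Set.indicator_of_mem hx, mul_one]
      rcases lt_or_ge |u x| (η * l) with h1 | h1
      · have : u x ^ 2 ≤ (η * l) ^ 2 := sq_le_sq' (by linarith [neg_abs_le (u x)])
          ((le_abs_self _).trans h1.le)
        linarith
      · rw [Set.indicator_of_mem (show x ∈ A from ⟨hx, h1⟩), mul_one]
        rcases le_total |u x| (L * l) with h2 | h2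
        · have : u x ^ 2 ≤ (L * l) ^ 2 := sq_le_sq' (by linarith [neg_abs_le (u x)])
            ((le_abs_self _).trans h2)
          linarith
        · have h3 : (L * l) ^ 4 ≤ u x ^ 4 := by
            rw [← (show Even 4 by decide).pow_abs (u x)]
            exact pow_le_pow_left₀ (by positivity) h2 4
          have h4 : u x ^ 2 ≤ 1 / (L * l) ^ 4 * u x ^ 6 := by
            rw [one_div, inv_mul_eq_div, le_div_iff₀ (by positivity)]
            calc u x ^ 2 * (L * l) ^ 4 ≤ u x ^ 2 * u x ^ 4 := by gcongr
              _ = _ := by ring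
          have : 0 ≤ (L * l) ^ 2 := by positivity
          linarith
    · rw [Set.indicator_of_notMem hx, Set.indicator_of_notMem hx, mul_zero]
      linarith
  have i1 : Integrable (fun x => (η * l) ^ 2 * S.indicator (fun _ => (1 : ℝ)) x) volume :=
    iS.const_mul _
  have i2 : Integrable (fun x => 1 / (L * l) ^ 4 * u x ^ 6) volume := hu6.const_mul _
  have i12 : Integrable (fun x => (η * l) ^ 2 * S.indicator (fun _ => (1 : ℝ)) x
      + 1 / (L * l) ^ 4 * u x ^ 6) volume := i1.add i2
  have i3 : Integrable (fun x => (L * l) ^ 2 * A.indicator (fun _ => (1 : ℝ)) x) volume :=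
    iA.const_mul _
  have hle := integral_mono (hu2.indicator hSm) (i12.add i3) hpt
  have e : ∫ x, ((η * l) ^ 2 * S.indicator (fun _ => (1 : ℝ)) x + 1 / (L * l) ^ 4 * u x ^ 6
        + (L * l) ^ 2 * A.indicator (fun _ => (1 : ℝ)) x)
      = (η * l) ^ 2 * s + 1 / (L * l) ^ 4 * (∫ x, u x ^ 6) + (L * l) ^ 2 * volume.real A := by
    rw [integral_add i12 i3, integral_add i1 i2, integral_const_mul, integral_const_mul,
      integral_const_mul, eS, eA]
  have b2 : 1 / (L * l) ^ 4 * (∫ x, u x ^ 6) ≤ d / 4 * l ^ 2 := by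
    calc 1 / (L * l) ^ 4 * (∫ x, u x ^ 6) ≤ 1 / (L * l) ^ 4 * (K * l ^ 6) := by gcongr
      _ = K / L ^ 4 * l ^ 2 := by field_simp
      _ ≤ _ := by gcongr
  have b1 : (η * l) ^ 2 * s ≤ d / 4 * l ^ 2 := by
    calc (η * l) ^ 2 * s = η ^ 2 * s * l ^ 2 := by ring
      _ ≤ _ := by gcongr
  have hfinal : d * l ^ 2 ≤ d / 4 * l ^ 2 + d / 4 * l ^ 2 + (L * l) ^ 2 * volume.real A := by
    calc _ ≤ _ := hmass
      _ ≤ _ := hle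
      _ = _ := e
      _ ≤ _ := by gcongr
  have h5 : d / 2 * l ^ 2 ≤ L ^ 2 * volume.real A * l ^ 2 := by nlinarith
  have h6 : d / 2 ≤ L ^ 2 * volume.real A := le_of_mul_le_mul_right h5 (by positivity)
  rw [div_le_iff₀ (by positivity)]
  linarith

/-- If `F(x, s) / s⁴ → ∞` for every `x`, then `F(x, s) ≥ k s⁴` for all large `|s|`, uniformly
outside a subset of `S` of small measure. -/
lemma exists_measure_bad_lt {F : R3 → ℝ → ℝ} (hF : Continuous (Function.uncurry F))
    (hlim : ∀ x, Tendsto (fun t : ℝ => F x t / t ^ 4) (comap (fun t : ℝ => |t|) atTop) atTop)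
    {S : Set R3} (hSm : MeasurableSet S) (hS : volume S < ⊤) (k : ℝ) {κ : ℝ} (hκ : 0 < κ) :
    ∃ r : ℝ, MeasurableSet {x ∈ S | ∃ s : ℝ, r ≤ |s| ∧ F x s < k * s ^ 4} ∧
      volume.real {x ∈ S | ∃ s : ℝ, r ≤ |s| ∧ F x s < k * s ^ 4} < κ := by
  set B : ℕ → Set R3 := fun n => {x ∈ S | ∃ s : ℝ, (n : ℝ) ≤ |s| ∧ F x s < k * s ^ 4} with hB
  have hBm : ∀ n, MeasurableSet (B n) := fun n => by
    have : {x : R3 | ∃ s : ℝ, (n : ℝ) ≤ |s| ∧ F x s < k * s ^ 4}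
        = ⋃ s : {s : ℝ // (n : ℝ) ≤ |s|}, {x | F x s < k * (s : ℝ) ^ 4} := by
      ext x; simp
    -- The union over `s` is uncountable, but each member is open by continuity of `F`.
    have hopen : IsOpen {x : R3 | ∃ s : ℝ, (n : ℝ) ≤ |s| ∧ F x s < k * s ^ 4} := by
      rw [this]
      exact isOpen_iUnion fun s => isOpen_lt
        (hF.comp (f := fun x : R3 => (x, (s : ℝ))) (by fun_prop)) continuous_const
    exact hSm.inter hopen.measurableSet
  have hanti : Antitone B := fun n n' hn x hx => by
    obtain ⟨hxS, s, hs, h⟩ := hx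
    exact ⟨hxS, s, le_trans (by exact_mod_cast hn) hs, h⟩
  have hempty : ⋂ n, B n = ∅ := by
    refine Set.eq_empty_iff_forall_notMem.mpr fun x hx => ?_
    have h1 := (hlim x).eventually_ge_atTop k
    rw [eventually_comap, eventually_atTop] at h1
    obtain ⟨R, hR⟩ := h1
    -- The `1` guarantees `s ≠ 0`, so that `s⁴` can be cleared.
    obtain ⟨n, hn⟩ := exists_nat_ge (max R 1)
    obtain ⟨-, s, hs, h⟩ := Set.mem_iInter.mp hx n
    have hs1 : max R 1 ≤ |s| := hn.trans hs
    have h2 := hR |s| ((le_max_left _ _).trans hs1) s rfl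
    have hs0 : s ≠ 0 := abs_pos.mp (one_pos.trans_le ((le_max_right _ _).trans hs1))
    have h4 : 0 < s ^ 4 := by positivity
    rw [le_div_iff₀ h4] at h2
    linarith
  -- Continuity from above, where the finite measure of `S` enters: the bad sets decrease to the
  -- empty set.
  have ht := tendsto_measure_iInter_atTop (μ := (volume : Measure R3))
    (fun n => (hBm n).nullMeasurableSet) hanti
    ⟨0, ((measure_mono fun x hx => hx.1).trans_lt hS).ne⟩
  rw [hempty, measure_empty] at ht
  obtain ⟨n, hn⟩ := (ht.eventually (gt_mem_nhds (ENNReal.ofReal_pos.mpr hκ))).exists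
  exact ⟨n, hBm n, ENNReal.toReal_lt_of_lt_ofReal hn⟩

/-- A lower bound for `∫ F(x, u)` that is superquartic in the scale `l`. -/
lemma exists_integral_ge_of_superquartic {F : R3 → ℝ → ℝ}
    (hF : Continuous (Function.uncurry F)) (hF0 : ∀ x t, 0 ≤ F x t)
    (hlim : ∀ x, Tendsto (fun t : ℝ => F x t / t ^ 4) (comap (fun t : ℝ => |t|) atTop) atTop)
    {S : Set R3} (hSm : MeasurableSet S) (hS : volume S < ⊤) {η κ : ℝ} (hη : 0 < η)
    (hκ : 0 < κ) (k : ℝ) : ∃ r : ℝ, ∀ (u : R3 → ℝ) (l : ℝ), r ≤ l → 0 < l →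
      AEStronglyMeasurable u volume → Integrable (fun x => F x (u x)) volume →
      κ ≤ volume.real {x ∈ S | η * l ≤ |u x|} → k * l ^ 4 ≤ ∫ x, F x (u x) := by
  -- Half of the measure `κ` survives removal of the bad set, and `q` is chosen so that `(κ/2)·q·η⁴
  -- = max k 0`.
  set q := max k 0 / (η ^ 4 * (κ / 2)) with hq
  have hq0 : 0 ≤ q := div_nonneg (le_max_right _ _) (by positivity)
  obtain ⟨r, hBm, hBκ⟩ := exists_measure_bad_lt hF hlim hSm hS q (half_pos hκ)
  set B : Set R3 := {x ∈ S | ∃ s : ℝ, r ≤ |s| ∧ F x s < q * s ^ 4} with hB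
  refine ⟨r / η, fun u l hrl hl hu hint hmass => ?_⟩
  rw [div_le_iff₀ hη, mul_comm] at hrl
  set A : Set R3 := {x ∈ S | η * l ≤ |u x|} with hA
  have hAn : NullMeasurableSet A volume :=
    hSm.nullMeasurableSet.inter (nullMeasurableSet_le aemeasurable_const hu.aemeasurable.abs)
  have hAfin : volume A ≠ ⊤ := ((measure_mono fun x hx => hx.1).trans_lt hS).ne
  have hBfin : volume B ≠ ⊤ := ((measure_mono fun x hx => hx.1).trans_lt hS).ne
  have hGn : NullMeasurableSet (A \ B) volume := hAn.diff hBm.nullMeasurableSet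
  have hGfin : volume (A \ B) ≠ ⊤ := measure_ne_top_of_subset Set.sdiff_subset hAfin
  have hG : κ / 2 ≤ volume.real (A \ B) := by
    have h1 : volume.real A ≤ volume.real (A \ B) + volume.real B :=
      (measureReal_mono (fun x hx => by
        by_cases hxB : x ∈ B
        · exact Or.inr hxB
        · exact Or.inl ⟨hx, hxB⟩) (measure_union_ne_top hGfin hBfin)).trans
        (measureReal_union_le _ _)
    linarith
  have iG : Integrable ((A \ B).indicator fun _ => q * (η * l) ^ 4) volume :=
    (integrableOn_const hGfin).integrable_indicator₀ hGn
  have hpt : ∀ x, (A \ B).indicator (fun _ => q * (η * l) ^ 4) x ≤ F x (u x) := fun x => by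
    by_cases hx : x ∈ A \ B
    · rw [Set.indicator_of_mem hx]
      obtain ⟨⟨hxS, hxu⟩, hxB⟩ := hx
      have h1 : q * u x ^ 4 ≤ F x (u x) := by
        by_contra hcon
        exact hxB ⟨hxS, u x, hrl.trans hxu, not_le.mp hcon⟩
      have h2 : (η * l) ^ 4 ≤ u x ^ 4 := by
        rw [← (show Even 4 by decide).pow_abs (u x)]
        exact pow_le_pow_left₀ (by positivity) hxu 4
      exact (mul_le_mul_of_nonneg_left h2 hq0).trans h1
    · rw [Set.indicator_of_notMem hx]
      exact hF0 _ _
  have hle := integral_mono iG hint hpt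
  rw [integral_indicator₀ hGn, setIntegral_const, smul_eq_mul] at hle
  calc k * l ^ 4 ≤ max k 0 * l ^ 4 := by gcongr; exact le_max_left _ _
    _ = κ / 2 * (q * (η * l) ^ 4) := by rw [hq]; field_simp
    _ ≤ volume.real (A \ B) * (q * (η * l) ^ 4) := by gcongr
    _ ≤ _ := hle

/-! ### The a priori bound and boundedness of Cerami sequences -/

/-- Points of the energy space with bounded energy and bounded `Φ'(u)u` are uniformly bounded. -/
theorem exists_norm_le_of_energy_le {a b : ℝ} (ha : 0 < a) (hb : 0 ≤ b) {V : C(R3, ℝ)} {m : ℝ}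
    (hm : ∀ x, m ≤ V x) {M : ℝ} (hM : 0 < M) (hS : volume {x | Vplus V x < M} < ⊤)
    {f : R3 → ℝ → ℝ} {C : ℝ} (hf : IsSobolevGrowth f C)
    (hlim : ∀ x, Tendsto (fun t : ℝ => primitive f x t / t ^ 4)
      (comap (fun t : ℝ => |t|) atTop) atTop)
    (hF0 : ∀ x t, 0 ≤ primitive f x t) (hAR : ∀ x t, 4 * primitive f x t ≤ t * f x t)
    {B : ℝ} (hB : 0 ≤ B) : ∃ R : ℝ, ∀ u : EnergySpace a ha V, |energy a ha b V f u| ≤ B →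
      |fderiv ℝ (energy a ha b V f) u u| ≤ B → ‖u‖ ≤ R := by
  obtain ⟨K, hK0, hK⟩ := EnergySpace.exists_embedding a ha V hM hS
  set S : Set R3 := {x | Vplus V x < M} with hSdef
  have hSm : MeasurableSet S := measurableSet_lt (continuous_Vplus V).measurable measurable_const
  set d := 1 / (2 * (|m| + 1)) with hd
  have hd0 : 0 < d := by positivity
  obtain ⟨η, κ, hη, hκ, hmass⟩ := exists_measure_superlevel_ge hSm hS hK0 hd0
  -- The extra `1` leaves a net `-‖u‖⁴` in the upper bound for the energy.
  obtain ⟨r, hr⟩ := exists_integral_ge_of_superquartic (F := primitive f) hf.continuous_primitive hF0 hlim hSm hS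
    hη hκ (b / (4 * a ^ 2) + 1)
  -- `|4Φ(u) - Φ'(u)u| ≤ 5B`, which is at most `½‖u‖²` once `‖u‖ ≥ 10B` and `‖u‖ ≥ 1`.
  refine ⟨max r (10 * B + 1), fun u hE hD => ?_⟩
  by_contra! hcon
  have hru : r ≤ ‖u‖ := (le_max_left _ _).trans hcon.le
  have hBu : 10 * B + 1 ≤ ‖u‖ := (le_max_right _ _).trans hcon.le
  have hu1 : 1 ≤ ‖u‖ := by linarith
  have hu0 : 0 < ‖u‖ := by linarith
  have hsq : ‖u‖ ≤ ‖u‖ ^ 2 := le_self_pow₀ hu1 (by norm_num)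
  have h1 := sub_quarter_fderiv_energy_ge hm hf hK0 hK hAR b u
  have hE' := abs_le.mp hE
  have hD' := abs_le.mp hD
  have h2 : 1 / 2 * ‖u‖ ^ 2 ≤ ∫ x, Vminus V x * u.toFun x ^ 2 := by linarith
  have h3 : ∫ x, Vminus V x * u.toFun x ^ 2
      ≤ (|m| + 1) * ∫ x, S.indicator (fun x => u.toFun x ^ 2) x := by
    rw [← integral_const_mul]
    refine integral_mono (integrable_Vminus_sq hm u)
      ((u.integrable_sq.indicator hSm).const_mul _) fun x => ?_
    simp only
    by_cases hx : x ∈ S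
    · rw [Set.indicator_of_mem hx]
      gcongr
      linarith [Vminus_le hm x]
    · rw [Set.indicator_of_notMem hx,
        Vminus_eq_zero_of_Vplus_pos (hM.trans_le (not_lt.mp hx))]
      simp
  have h4 : d * ‖u‖ ^ 2 ≤ ∫ x, S.indicator (fun x => u.toFun x ^ 2) x := by
    have h5 := h2.trans h3
    rw [hd, one_div, inv_mul_eq_div, div_le_iff₀ (by positivity)]
    linarith
  have h6 := hmass u.toFun ‖u‖ hu0 u.aestronglyMeasurable u.integrable_sq (hK u).1 (hK u).2.2 h4
  have h7 := hr u.toFun ‖u‖ hru hu0 u.aestronglyMeasurable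
    (hf.integrable_primitive u.aestronglyMeasurable u.integrable_sq (hK u).1) h6
  have h8 := energy_le hm hf hK hb u
  have h9 : ‖u‖ ^ 2 ≤ ‖u‖ ^ 4 := pow_le_pow_right₀ hu1 (by norm_num)
  -- Now `Φ(u) ≤ ½‖u‖² - ‖u‖⁴ ≤ -½‖u‖² < -B`, against `|Φ(u)| ≤ B`.
  linarith

end Kirchhoff

end

theorem lemma3p2
    -- the constants of the equation
    (a b : ℝ) (ha : 0 < a) (hb : 0 < b)
    -- (V1): `V` is continuous, bounded below, and `{V⁺ < M}` is nonempty of finite measure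
    (V : C(Kirchhoff.R3, ℝ))
    (hV_below : ∃ m : ℝ, ∀ x, m ≤ V x)
    (hV_level : ∃ M : ℝ, 0 < M ∧ {x | Kirchhoff.Vplus V x < M}.Nonempty ∧
      MeasureTheory.volume {x | Kirchhoff.Vplus V x < M} < ⊤)
    -- (f1): `f` is of class C¹ with subcritical growth of exponent `p - 1`
    (f : Kirchhoff.R3 → ℝ → ℝ)
    (hf_C1 : ContDiff ℝ 1 (fun z : Kirchhoff.R3 × ℝ => f z.1 z.2))
    (p : ℝ) (hp : 2 < p) (hp6 : p < 6)
    (hf_growth : ∃ C : ℝ, 0 < C ∧ ∀ x t, |f x t| ≤ C * (1 + |t| ^ (p - 1)))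
    -- (f2): `f(x, t) = o(t)` as `t → 0`, uniformly in `x`, and `F(x, t) / t⁴ → +∞` as `|t| → ∞`
    (hf_zero : ∀ ε : ℝ, 0 < ε → ∃ δ : ℝ, 0 < δ ∧ ∀ x t, |t| < δ → |f x t| ≤ ε * |t|)
    (hf_superlinear : ∀ x, Filter.Tendsto (fun t : ℝ => Kirchhoff.primitive f x t / t ^ 4)
      (Filter.comap (fun t : ℝ => |t|) Filter.atTop) Filter.atTop)
    -- (f3), where `p'` is the exponent conjugate to `p`
    (p' : ℝ) (hpp' : 1 / p + 1 / p' = 1)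
    (hf_quot : ∃ a₀ b₀ α : ℝ, 0 < a₀ ∧ 0 < b₀ ∧ 0 < α ∧ α < min p' (5 * p' - 6) ∧
      ∀ x t, t ≠ 0 →
        0 < (4 + 1 / (a₀ * |t| ^ α + b₀)) * Kirchhoff.primitive f x t ∧
        (4 + 1 / (a₀ * |t| ^ α + b₀)) * Kirchhoff.primitive f x t ≤ t * f x t)
    -- a Cerami sequence at an arbitrary level
    (c : ℝ) (u : ℕ → Kirchhoff.EnergySpace a ha V)
    (hu : Kirchhoff.IsCeramiSeq (Kirchhoff.energy a ha b V f) c u) :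
    Bornology.IsBounded (Set.range u) := by
  obtain ⟨m, hm⟩ := hV_below
  obtain ⟨M, hM, -, hS⟩ := hV_level
  obtain ⟨C, hC, hgrowth⟩ := hf_growth
  obtain ⟨δ, hδ, hzero⟩ := hf_zero 1 one_pos
  obtain ⟨a₀, b₀, α, ha₀, hb₀, -, -, hquot⟩ := hf_quot
  obtain ⟨C', hf⟩ := Kirchhoff.exists_isSobolevGrowth hf_C1.continuous (by linarith) hp6.le hC.le
    hgrowth hδ hzero
  have hF : ∀ x t, 0 ≤ Kirchhoff.primitive f x t ∧
      4 * Kirchhoff.primitive f x t ≤ t * f x t := by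
    intro x t
    rcases eq_or_ne t 0 with rfl | ht
    · simp [Kirchhoff.primitive]
    · obtain ⟨h1, h2⟩ := hquot x t ht
      -- Positivity of this quotient yields `F > 0` and weakens (f3) to `4F ≤ t f`.
      have hq : 0 < 1 / (a₀ * |t| ^ α + b₀) := by positivity
      have hpos : 0 < Kirchhoff.primitive f x t := pos_of_mul_pos_right h1 (by linarith)
      exact ⟨hpos.le, by nlinarith⟩
  obtain ⟨hΦ, hΦ'⟩ := hu
  obtain ⟨B₁, hB₁⟩ := hΦ.abs.bddAbove_range
  obtain ⟨B₂, hB₂⟩ := hΦ'.bddAbove_range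
  obtain ⟨R, hR⟩ := Kirchhoff.exists_norm_le_of_energy_le ha hb.le hm hM hS hf hf_superlinear
    (fun x t => (hF x t).1) (fun x t => (hF x t).2) (le_max_right (max B₁ B₂) 0)
  refine isBounded_iff_forall_norm_le.mpr ⟨R, ?_⟩
  rintro _ ⟨n, rfl⟩
  refine hR (u n) ?_ ?_
  · exact (hB₁ ⟨n, rfl⟩).trans ((le_max_left _ _).trans (le_max_left _ _))
  · refine le_trans ?_ ((hB₂ ⟨n, rfl⟩).trans ((le_max_right _ _).trans (le_max_left _ _)))
    -- The Cerami weight is used here: `‖u‖ ≤ 1 + ‖u‖` turns decay of the weighted derivative into a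
    -- bound on `Φ'(u)u`.
    calc |fderiv ℝ (Kirchhoff.energy a ha b V f) (u n) (u n)|
        ≤ ‖fderiv ℝ (Kirchhoff.energy a ha b V f) (u n)‖ * ‖u n‖ :=
          (Real.norm_eq_abs _).symm.trans_le (ContinuousLinearMap.le_opNorm _ _)
      _ ≤ (1 + ‖u n‖) * ‖fderiv ℝ (Kirchhoff.energy a ha b V f) (u n)‖ := by
          rw [mul_comm]
          gcongr
          linarith
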